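/- Let $N>1$ be an integer, let $\alpha,\beta\in\mathbb C$, and put $q:=\alpha+\beta$, $k:=\alpha-\beta$. Assume $\operatorname{Re}(q)>2$ and $k\in 2\mathbb Z$. Let $z=x+iy$ with $x,y\in\mathbb R$, $y>0$. Define $$(\mathbb Z\times\mathbb Z)_{N,L}:=\bigsqcup_{t\ge 1}\{(m,n)\in t\mathbb Z\times t\mathbb Z:\gcd(Nm,n)=t\},\qquad (\mathbb Z\times\mathbb Z)_{N,R}:=\bigsqcup_{t\ge 1}\{(m,n)\in t\mathbb Z\times t\mathbb Z:\gcd(m,Nn)=t\},$$ and $g_N:=g_{N,L}+g_{N,R}$, where $$g_{N,L}(z,\overline z,\alpha,\beta):=\sum_{(m,n)\in(\mathbb Z\times\mathbb Z)_{N,L}}(\sqrt N mz+n)^{-\alpha}(\sqrt N m\overline z+n)^{-\beta},$$ $$g_{N,R}(z,\overline z,\alpha,\beta):=\sum_{(m,n)\in(\mathbb Z\times\mathbb Z)_{N,R}}(mz+\sqrt N n)^{-\alpha}(m\overline z+\sqrt N n)^{-\beta};$$ here $w^{-\alpha}\overline w^{-\beta}:=e^{-\alpha\log w-\beta\overline{\log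 w}}=|w|^{-2\beta}w^{-k}$. For $b\in\mathbb Z$ let $G(b,\mathbb 1_n):=\sum_{a\in(\mathbb Z/n\mathbb Z)^\times}e^{2\pi i ab/n}$ be the Ramanujan sum, and put $$\mathcal L(b,\mathbb 1_\bullet,s):=\sum_{n\ge1}\frac{G(b,\mathbb 1_n)}{n^s},\qquad \mathcal L(b,\mathbb 1_{N\bullet},s):=\sum_{n\ge1}\frac{G(b,\mathbb 1_{Nn})}{n^s},\qquad \mathcal L_N(b,\mathbb 1_\bullet,s):=\prod_{p\mid N}\sum_{n\ge0}\frac{G(b,\mathbb 1_{p^n})}{p^{ns}}.$$ For real $t\neq0$ let $W(t;\alpha,\beta):=|t|^{-q/2}\,W_{\operatorname{sgn}(t)\frac k2,\frac{q-1}2}(2|t|)$, where $W_{\kappa,\mu}$ is the Whittaker $W$-function, that is, for $u>0$, the analytic continuation in $(\kappa,\mu)$ of $$W_{\kappa,\mu}(u)=\frac{u^{\frac12-\mu}e^{-u/2}}{\Gamma(\mu+\frac12-\kappa)}\int_0^\infty e^{-v}v^{\mu-\kappa-\frac12}(v+u)^{\mu+\kappa-\frac12}\,dv\qquad(\operatorname{Re}(\mu+\tfrac12-\kappa)>0).$$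 Then the series defining $g_{N,L}$, $g_{N,R}$, $\mathcal L(n,\mathbb 1_{N\bullet},q)$, $\mathcal L(n,\mathbb 1_\bullet,q)$ and the series in $\mathcal L_N(n,\mathbb 1_\bullet,q)$ converge absolutely, $\mathcal L_N(n,\mathbb 1_\bullet,q)\neq0$ for all $n\in\mathbb Z$, and $g_N$ has the following (absolutely convergent) Fourier expansion in $x$, with period $\sqrt N$: $$\begin{aligned}g_N(z,\overline z,\alpha,\beta)=\phi_N(y,q,k)+{}&2(-1)^{k/2}\zeta(q)\left(\frac{\sqrt2\,\pi}{\sqrt N}\right)^{q}\sum_{n\neq0}\frac{|n|^{q-1}}{\Gamma\left(\frac q2+\operatorname{sgn}(n)\frac k2\right)}W\left(2\pi n\frac{y}{\sqrt N};\alpha,\beta\right)\\&\times\left(N^{-q/2}\mathcal L(n,\mathbb 1_{N\bullet},q)+\frac{\mathcal L(n,\mathbb 1_\bullet,q)}{\mathcal L_N(n,\mathbb 1_\bullet,q)}\right)e^{2\pi i nx/\sqrt N},\end{aligned}$$ where $$\phi_N(y,q,k):=2\zeta(q)+2(-1)^{k/2}N^{-q/2}\zeta(q)\left(\frac{2y}{\sqrt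 N}\right)^{1-q}\frac{2\pi\,\Gamma(q-1)}{\Gamma(\frac{q+k}2)\Gamma(\frac{q-k}2)}\left(N^{-q/2}\mathcal L(0,\mathbb 1_{N\bullet},q)+\frac{\mathcal L(0,\mathbb 1_\bullet,q)}{\mathcal L_N(0,\mathbb 1_\bullet,q)}\right).$$ As usual, $1/\Gamma$ is the entire function that vanishes at the poles of $\Gamma$. -/

import Mathlib

open scoped Real

noncomputable section

/-- `w ^ a * (conj w) ^ b`, where the two powers are taken with conjugate logarithms,
`log (conj w) = conj (log w)`. When `a - b` is an even integer this does not depend on the branch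
of `log w`; it equals `|w| ^ (2 * b) * w ^ (a - b)`, also for negative real `w`. -/
def conjPow (w a b : ℂ) : ℂ :=
  Complex.exp (a * Complex.log w) * Complex.exp (b * (starRingEnd ℂ) (Complex.log w))

/-- The set `(ℤ × ℤ)_{N,L}`: the disjoint union over `t > 0` of the sets of pairs
`(m, n) ∈ tℤ × tℤ` such that `gcd (N m, n) = t`. -/
def latticeL (N : ℕ) : Set (ℤ × ℤ) :=
  ⋃ t : {t : ℕ // 0 < t},
    {p | (t : ℤ) ∣ p.1 ∧ (t : ℤ) ∣ p.2 ∧ Int.gcd ((N : ℤ) * p.1) p.2 = t}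

/-- The set `(ℤ × ℤ)_{N,R}`: the disjoint union over `t > 0` of the sets of pairs
`(m, n) ∈ tℤ × tℤ` such that `gcd (m, N n) = t`. -/
def latticeR (N : ℕ) : Set (ℤ × ℤ) :=
  ⋃ t : {t : ℕ // 0 < t},
    {p | (t : ℤ) ∣ p.1 ∧ (t : ℤ) ∣ p.2 ∧ Int.gcd p.1 ((N : ℤ) * p.2) = t}

/-- The summand `(√N m z + n) ^ (-α) * (√N m conj z + n) ^ (-β)`. -/
def eisTermL (N : ℕ) (z : UpperHalfPlane) (α β : ℂ) (p : ℤ × ℤ) : ℂ :=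
  conjPow ((√(N : ℝ) : ℝ) * (p.1 : ℂ) * (z : ℂ) + (p.2 : ℂ)) (-α) (-β)

/-- The summand `(m z + √N n) ^ (-α) * (m conj z + √N n) ^ (-β)`. -/
def eisTermR (N : ℕ) (z : UpperHalfPlane) (α β : ℂ) (p : ℤ × ℤ) : ℂ :=
  conjPow ((p.1 : ℂ) * (z : ℂ) + (√(N : ℝ) : ℝ) * (p.2 : ℂ)) (-α) (-β)

/-- The series `g_{N,L}(z, conj z, α, β)`. -/
def eisL (N : ℕ) (z : UpperHalfPlane) (α β : ℂ) : ℂ :=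
  ∑' p : latticeL N, eisTermL N z α β p

/-- The series `g_{N,R}(z, conj z, α, β)`. -/
def eisR (N : ℕ) (z : UpperHalfPlane) (α β : ℂ) : ℂ :=
  ∑' p : latticeR N, eisTermR N z α β p

/-- The non-holomorphic Eisenstein series `g_N = g_{N,L} + g_{N,R}` for `R(N)`. -/
def eis (N : ℕ) (z : UpperHalfPlane) (α β : ℂ) : ℂ :=
  eisL N z α β + eisR N z α β

/-- The Ramanujan sum `G(b, 𝟙_n)`: the sum of the `b`-th powers of the primitive `n`-th roots
of unity `exp (2 π i a / n)`, where `a` runs over the residues modulo `n` prime to `n`. -/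
def ramanujanG (b : ℤ) (n : ℕ) : ℂ :=
  ∑ a ∈ (Finset.range n).filter (fun a => Nat.Coprime a n),
    Complex.exp (2 * π * Complex.I * (a : ℂ) / (n : ℂ)) ^ b

/-- `𝓛(b, 𝟙_•, s) = ∑_{n ≥ 1} G(b, 𝟙_n) n ^ (-s)`. -/
def ramanujanL (b : ℤ) (s : ℂ) : ℂ :=
  LSeries (fun n => ramanujanG b n) s

/-- `𝓛(b, 𝟙_{N•}, s) = ∑_{n ≥ 1} G(b, 𝟙_{N n}) n ^ (-s)`. -/
def ramanujanLShift (N : ℕ) (b : ℤ) (s : ℂ) : ℂ :=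
  LSeries (fun n => ramanujanG b (N * n)) s

/-- `𝓛_N(b, 𝟙_•, s) = ∏_{p ∣ N} ∑_{n ≥ 0} G(b, 𝟙_{p ^ n}) p ^ (-n s)`. -/
def ramanujanLLocal (N : ℕ) (b : ℤ) (s : ℂ) : ℂ :=
  ∏ p ∈ N.primeFactors, ∑' n : ℕ, ramanujanG b (p ^ n) / (p : ℂ) ^ ((n : ℂ) * s)

/-- The Whittaker function `W_{κ,μ}(y)` for `y > 0`. For `Re (μ + 1/2 - κ) > 0` we have `m = 0`
below, and the formula is the classical integral representation
`y ^ (1/2 - μ) * exp (-y/2) / Γ(μ + 1/2 - κ) *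
  ∫_0^∞ exp (-u) * u ^ (μ - κ - 1/2) * (u + y) ^ (μ + κ - 1/2) du`.
In general it is the analytic continuation of that formula in the parameters, obtained by `m`
integrations by parts in `u`, with `m` the least natural number such that
`Re (μ + 1/2 - κ) + m > 0`. -/
def whittakerW (κ μ : ℂ) (y : ℝ) : ℂ :=
  let a : ℂ := μ + 1 / 2 - κ
  let m : ℕ := (⌊-a.re⌋ + 1).toNat
  (y : ℂ) ^ (1 / 2 - μ) * Complex.exp (-(y : ℂ) / 2) * ((-1) ^ m / Complex.Gamma (a + m)) *
    ∫ u in Set.Ioi (0 : ℝ), (u : ℂ) ^ (a + m - 1) *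
      iteratedDeriv m
        (fun v : ℝ => Complex.exp (-(v : ℂ)) * ((v + y : ℝ) : ℂ) ^ (μ + κ - 1 / 2)) u

/-- The modified Whittaker function: with `q = α + β` and `k = α - β`,
`W(t; α, β) = |t| ^ (-q/2) * W_{sgn(t) k/2, (q-1)/2}(2 |t|)` for real `t ≠ 0`. -/
def modWhittakerW (t : ℝ) (α β : ℂ) : ℂ :=
  ((|t| : ℝ) : ℂ) ^ (-(α + β) / 2) *
    whittakerW ((Real.sign t : ℂ) * (α - β) / 2) ((α + β - 1) / 2) (2 * |t|)

/-- The arithmetic factor `N ^ (-q/2) 𝓛(n, 𝟙_{N•}, q) + 𝓛(n, 𝟙_•, q) / 𝓛_N(n, 𝟙_•, q)`. -/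
def eisArith (N : ℕ) (n : ℤ) (q : ℂ) : ℂ :=
  (N : ℂ) ^ (-q / 2) * ramanujanLShift N n q + ramanujanL n q / ramanujanLLocal N n q

/-- The constant term `φ_N(y, q, k)`, for an even integer `k`. The factor `1 / Γ` is read as the
entire function `1 / Γ`, which vanishes at the poles of `Γ`. -/
def eisConst (N : ℕ) (y : ℝ) (q : ℂ) (k : ℤ) : ℂ :=
  2 * riemannZeta q +
    2 * (-1) ^ (k / 2) * (N : ℂ) ^ (-q / 2) * riemannZeta q *
      ((2 * y / √(N : ℝ) : ℝ) : ℂ) ^ (1 - q) *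
      (2 * π * Complex.Gamma (q - 1) /
        (Complex.Gamma ((q + k) / 2) * Complex.Gamma ((q - k) / 2))) *
      eisArith N 0 q

/-- The `n`-th term, `n ≠ 0`, of the Fourier expansion of `g_N` (before multiplication by
`2 (-1) ^ (k/2) ζ(q) (√2 π / √N) ^ q`). -/
def eisFourierTerm (N : ℕ) (z : UpperHalfPlane) (α β : ℂ) (n : ℤ) : ℂ :=
  ((|n| : ℤ) : ℂ) ^ (α + β - 1) /
      Complex.Gamma ((α + β) / 2 + (n.sign : ℂ) * ((α - β) / 2)) *
    modWhittakerW (2 * π * n * z.im / √(N : ℝ)) α β *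
    eisArith N n (α + β) *
    Complex.exp (2 * π * Complex.I * n * z.re / (√(N : ℝ) : ℝ))

end

section

open Complex Set MeasureTheory Filter Topology Asymptotics FourierTransform
open scoped UpperHalfPlane

/-! Put `τ = z / √N` and `q = α + β`. Taking `√N` out of the linear forms turns `g_{N,L}` into a sum
of `(M τ + n) ^ (-α) (M τ̄ + n) ^ (-β)` over rows `M = N m`, and `g_{N,R}` into `N ^ (-q/2)` times
such a sum over rows `M = m`. Each index set consists of the positive multiples of its primitive
pairs, so homogeneity of degree `-q` splits off `ζ(q)`, and evenness (`k` is even) folds the rows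
`M` and `-M` together. Row zero of the primitive pairs is `(0, ±1)` for L, whence `2 ζ(q)`, and
empty for R because `N > 1`.

A row `M > 0` runs over the `n` prime to `M`. Sorted by residue `a` modulo `M`, it is a union of
full translates of `ℤ`. Poisson summation turns the translation by `a / M` into the phase `e ^ (2 π
i ν a / M)`, and summing over `a` yields the Ramanujan sum `G(ν, M)` (`tsum_coprime_conjPow`).
Summing over `M` gives Dirichlet series: the multiples of `N` give the shifted series, and the `M`
prime to `N` give the Euler product without its factors at `p ∣ N` (`tsum_coprime_ramanujanG`). The
bound `|G(ν, M)| ≤ M`, uniform in `ν`, together with `Re q > 2` and summable Fourier coefficients,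
justifies the exchange of sums (`eis_eq`).

It remains to transform `(v - i x) ^ (-a) (v + i x) ^ (-b)`. When both real parts are positive, each
factor is, up to constants and reflection, the Fourier transform of a gamma density, and the product
becomes a correlation integral of two gamma densities: a Whittaker integral at `ξ > 0`, a gamma
integral at `ξ = 0`. Other exponents are reached by induction, since both sides obey one contiguous
relation, which comes from `2 v = (v - i x) + (v + i x)` on one side and from integration by parts
on the other (`fourier_linePowMul_of_pos`, `fourier_linePowMul_zero`). -/

theorem HasDerivAt.cpow_const_of_mem_slitPlane {f : ℝ → ℂ} {f' : ℂ} {x : ℝ}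
    (hf : HasDerivAt f f' x) (c : ℂ) (h : f x ∈ slitPlane) :
    HasDerivAt (fun x => f x ^ c) (c * f x ^ (c - 1) * f') x :=
  HasDerivAt.comp x (hasStrictDerivAt_cpow_const (c := c) h).hasDerivAt hf

/-! ### The regularized confluent integral -/

/-- The function `e ^ (-u) * (u + y) ^ (b - 1)` integrated in the Whittaker function. -/
noncomputable def whittakerKernel (b : ℂ) (y : ℝ) (u : ℝ) : ℂ :=
  cexp (-(u : ℂ)) * ((u + y : ℝ) : ℂ) ^ (b - 1)

/-- The integral `Γ(a)⁻¹ ∫ u ^ (a - 1) e ^ (-u) (u + y) ^ (b - 1) du`, regularized for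
`Re a ≤ 0` by integration by parts. -/
noncomputable def whittakerReg (a b : ℂ) (y : ℝ) : ℂ :=
  (-1) ^ (⌊-a.re⌋ + 1).toNat / Gamma (a + (⌊-a.re⌋ + 1).toNat) *
    ∫ u in Ioi (0 : ℝ), (u : ℂ) ^ (a + (⌊-a.re⌋ + 1).toNat - 1) *
      iteratedDeriv (⌊-a.re⌋ + 1).toNat (whittakerKernel b y) u

/-- Trades `(κ, μ)` for the two exponents of the integrand, in which the contiguous relations are
unit shifts. -/
theorem whittakerW_eq (κ μ : ℂ) (y : ℝ) :
    whittakerW κ μ y = (y : ℂ) ^ (1 / 2 - μ) * cexp (-(y : ℂ) / 2) *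
      whittakerReg (μ + 1 / 2 - κ) (μ + κ + 1 / 2) y := by
  have : (fun v : ℝ => cexp (-(v : ℂ)) * ((v + y : ℝ) : ℂ) ^ (μ + κ - 1 / 2)) =
      whittakerKernel (μ + κ + 1 / 2) y := by
    ext v
    rw [whittakerKernel]
    ring_nf
  simp only [whittakerW, whittakerReg, this]
  ring

theorem contDiffAt_whittakerKernel (b : ℂ) {y u : ℝ} (h : 0 < u + y) (n : WithTop ℕ∞) :
    ContDiffAt ℝ n (whittakerKernel b y) u := by
  have h1 : ContDiffAt ℝ n (fun u : ℝ => ((u + y : ℝ) : ℂ)) u :=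
    (ofRealCLM.contDiff.contDiffAt).comp u (contDiffAt_id.add contDiffAt_const)
  have h0 : ContDiffAt ℝ n (fun u : ℝ => -(u : ℂ)) u := ofRealCLM.contDiff.contDiffAt.neg
  have h2 : ContDiffAt ℂ n (fun w : ℂ => w ^ (b - 1)) ((u + y : ℝ) : ℂ) :=
    (analyticAt_id.cpow analyticAt_const (ofReal_mem_slitPlane.2 h)).contDiffAt
  exact h0.cexp.mul (ContDiffAt.comp (g := fun w : ℂ => w ^ (b - 1)) u (h2.restrict_scalars ℝ) h1)

theorem hasDerivAt_whittakerKernel (b : ℂ) {y u : ℝ} (h : 0 < u + y) :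
    HasDerivAt (whittakerKernel b y)
      ((b - 1) * whittakerKernel (b - 1) y u - whittakerKernel b y u) u := by
  have h1 : HasDerivAt (fun u : ℝ => ((u + y : ℝ) : ℂ)) 1 u :=
    ((hasDerivAt_id u).add_const y).ofReal_comp
  have h2 : HasDerivAt (fun u : ℝ => cexp (-(u : ℂ))) (cexp (-(u : ℂ)) * -1) u :=
    ((hasDerivAt_id u).ofReal_comp.neg).cexp
  have h3 := h1.cpow_const_of_mem_slitPlane (b - 1) (ofReal_mem_slitPlane.2 h)
  refine (h2.mul h3).congr_deriv ?_
  simp only [whittakerKernel]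
  ring

/-- Differentiation stays in the span of the kernels with lowered `b`, so integrability and
recurrences of the regularized integral reduce to lower order. -/
theorem iteratedDeriv_succ_whittakerKernel (b : ℂ) {y u : ℝ} (h : 0 < u + y) (m : ℕ) :
    iteratedDeriv (m + 1) (whittakerKernel b y) u =
      (b - 1) * iteratedDeriv m (whittakerKernel (b - 1) y) u -
        iteratedDeriv m (whittakerKernel b y) u := by
  rw [iteratedDeriv_succ']
  have : deriv (whittakerKernel b y) =ᶠ[𝓝 u]
      (fun u => (b - 1) * whittakerKernel (b - 1) y u) - whittakerKernel b y := by
    have : ∀ᶠ x in 𝓝 u, 0 < x + y :=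
      (continuous_id.add continuous_const).continuousAt.eventually (lt_mem_nhds h)
    filter_upwards [this] with x hx
    rw [(hasDerivAt_whittakerKernel b hx).deriv]
    rfl
  rw [this.iteratedDeriv_eq, iteratedDeriv_sub, iteratedDeriv_const_mul_field]
  · exact contDiffAt_const.mul (contDiffAt_whittakerKernel _ h _)
  · exact contDiffAt_whittakerKernel _ h _

theorem integrableOn_cpow_mul_whittakerKernel {s : ℂ} (hs : 0 < s.re) (b : ℂ) {y : ℝ}
    (hy : 0 < y) :
    IntegrableOn (fun u : ℝ => (u : ℂ) ^ (s - 1) * whittakerKernel b y u) (Ioi 0) := by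
  have hc : ∀ u ∈ Ici (0 : ℝ), ContinuousAt (whittakerKernel b y) u := fun u hu =>
    (hasDerivAt_whittakerKernel b (by have : 0 ≤ u := hu; positivity)).continuousAt
  refine mellinConvergent_of_isBigO_rpow_exp (a := 1 / 2) (b := 0) (by norm_num)
    (f := whittakerKernel b y) ?_ ?_ ?_ hs
  · refine ContinuousOn.locallyIntegrableOn (fun u hu => ?_) measurableSet_Ioi
    exact (hc u (Ioi_subset_Ici_self hu)).continuousWithinAt
  -- The power of `u + y` is absorbed by half of the exponential decay, which leaves `e ^ (-u / 2)`.
  · have h1 := (isLittleO_rpow_exp_pos_mul_atTop (b - 1).re (b := 1 / 2) (by norm_num)).isBigO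
    have h2 := h1.comp_tendsto (tendsto_atTop_add_const_right atTop y tendsto_id)
    have h3 : (fun u : ℝ => Real.exp (1 / 2 * (u + y))) =O[atTop]
        (fun u : ℝ => Real.exp (1 / 2 * u)) := by
      refine IsBigO.of_bound (Real.exp (1 / 2 * y)) (Eventually.of_forall fun u => ?_)
      rw [Real.norm_of_nonneg (Real.exp_pos _).le, Real.norm_of_nonneg (Real.exp_pos _).le,
        ← Real.exp_add]
      exact (congrArg _ (by ring)).le
    have h4 := (isBigO_refl (fun u : ℝ => Real.exp (-u)) atTop).mul (h2.trans h3)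
    refine IsBigO.trans (IsBigO.of_bound 1 ?_) (h4.congr_right fun u => ?_)
    · filter_upwards [eventually_gt_atTop 0] with u hu
      simp only [whittakerKernel, norm_mul, Function.comp]
      rw [norm_cpow_eq_rpow_re_of_pos (by positivity), norm_exp]
      simp only [neg_re, ofReal_re, id, one_mul, Real.norm_eq_abs, Real.abs_exp]
      gcongr
      exact le_abs_self _
    · rw [← Real.exp_add]
      ring_nf
  · simp only [neg_zero, Real.rpow_zero]
    exact ((hc 0 self_mem_Ici).tendsto.mono_left nhdsWithin_le_nhds).isBigO_one ℝ

theorem integrableOn_cpow_mul_iteratedDeriv {s : ℂ} (hs : 0 < s.re) {y : ℝ} (hy : 0 < y)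
    (m : ℕ) : ∀ b : ℂ,
    IntegrableOn (fun u : ℝ => (u : ℂ) ^ (s - 1) * iteratedDeriv m (whittakerKernel b y) u)
      (Ioi 0) := by
  induction m with
  | zero => simpa using fun b => integrableOn_cpow_mul_whittakerKernel hs b hy
  | succ m ih =>
    intro b
    have hi : IntegrableOn _ (Ioi (0 : ℝ)) := ((ih (b - 1)).const_mul (b - 1)).sub (ih b)
    refine hi.congr_fun (fun u hu => ?_) measurableSet_Ioi
    have hu : 0 < u := hu
    simp only [Pi.sub_apply]
    rw [iteratedDeriv_succ_whittakerKernel b (by positivity)]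
    ring

theorem whittakerReg_of_re_pos {a : ℂ} (ha : 0 < a.re) (b : ℂ) (y : ℝ) :
    whittakerReg a b y =
      (Gamma a)⁻¹ * ∫ u in Ioi (0 : ℝ), (u : ℂ) ^ (a - 1) * whittakerKernel b y u := by
  have : (⌊-a.re⌋ + 1).toNat = 0 := by
    rw [Int.toNat_eq_zero]
    have : ⌊-a.re⌋ < 0 := Int.floor_lt.2 (by simpa using ha)
    omega
  simp [whittakerReg, this]

/-- Integration by parts. The boundary terms vanish: at `0` because `Re a > 0`, at infinity because
the function and its derivative are both integrable. -/
theorem integral_cpow_mul_whittakerKernel_succ {a : ℂ} (ha : 0 < a.re) (b : ℂ) {y : ℝ}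
    (hy : 0 < y) :
    a * ∫ u in Ioi (0 : ℝ), (u : ℂ) ^ (a - 1) * whittakerKernel b y u =
      (∫ u in Ioi (0 : ℝ), (u : ℂ) ^ a * whittakerKernel b y u) -
        (b - 1) * ∫ u in Ioi (0 : ℝ), (u : ℂ) ^ a * whittakerKernel (b - 1) y u := by
  have ha0 : a ≠ 0 := by rintro rfl; simp at ha
  have i1 := (integrableOn_cpow_mul_whittakerKernel ha b hy).const_mul a
  have i2 : ∀ b, IntegrableOn (fun u : ℝ => (u : ℂ) ^ a * whittakerKernel b y u) (Ioi 0) := by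
    intro b
    simpa using integrableOn_cpow_mul_whittakerKernel (s := a + 1)
      (by simp; positivity) b hy
  have i3 := (i2 (b - 1)).const_mul (b - 1)
  have hd : ∀ u ∈ Ioi (0 : ℝ), HasDerivAt (fun u : ℝ => (u : ℂ) ^ a * whittakerKernel b y u)
      (a * ((u : ℂ) ^ (a - 1) * whittakerKernel b y u) +
        ((b - 1) * ((u : ℂ) ^ a * whittakerKernel (b - 1) y u) -
          (u : ℂ) ^ a * whittakerKernel b y u)) u := by
    intro u hu
    have hu : 0 < u := hu
    have h1 := (hasDerivAt_id u).ofReal_comp.cpow_const_of_mem_slitPlane a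
      (ofReal_mem_slitPlane.2 hu)
    refine (h1.mul (hasDerivAt_whittakerKernel b (y := y) (by positivity))).congr_deriv ?_
    simp only [id]
    push_cast
    ring
  have hi := i1.add (i3.sub (i2 b))
  have h0 := integral_Ioi_of_hasDerivAt_of_tendsto (f := fun u : ℝ =>
    (u : ℂ) ^ a * whittakerKernel b y u) ?_ hd hi
    (tendsto_zero_of_hasDerivAt_of_integrableOn_Ioi hd hi (i2 b))
  · have e := integral_add i1 (i3.sub (i2 b))
    simp only [Pi.sub_apply] at e h0
    rw [h0, integral_sub i3 (i2 b), integral_const_mul, integral_const_mul] at e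
    simp only [ofReal_zero, zero_cpow ha0, zero_mul, sub_zero] at e
    linear_combination -e
  · refine ContinuousAt.continuousWithinAt (ContinuousAt.mul ?_ ?_)
    · exact (continuousAt_ofReal_cpow_const 0 a (Or.inl ha))
    · exact (hasDerivAt_whittakerKernel b (by simpa using hy)).continuousAt

/-- The contiguous relation that carries the Fourier formula to exponents with nonpositive real
part. -/
theorem whittakerReg_sub_one (a b : ℂ) {y : ℝ} (hy : 0 < y) :
    whittakerReg (a - 1) b y = whittakerReg a b y - (b - 1) * whittakerReg a (b - 1) y := by
  by_cases h : 0 < (a - 1).re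
  · have h' : 0 < a.re := by simp at h; linarith
    rw [whittakerReg_of_re_pos h, whittakerReg_of_re_pos h', whittakerReg_of_re_pos h']
    have e := integral_cpow_mul_whittakerKernel_succ h b hy
    have g := one_div_Gamma_eq_self_mul_one_div_Gamma_add_one (a - 1)
    rw [sub_add_cancel] at g
    rw [g]
    linear_combination (Gamma a)⁻¹ * e
  -- Here the regularization orders at `a - 1` and `a` are `m + 1` and `m`, so the two integrals
  -- carry the same power of `u`, and the relation is the derivative rule for the kernel under the
  -- integral sign.
  · set m := (⌊-a.re⌋ + 1).toNat with hm
    have hm1 : (⌊-(a - 1).re⌋ + 1).toNat = m + 1 := by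
      have e : -(a - 1).re = -a.re + (1 : ℤ) := by simp; ring
      -- This keeps `toNat` from truncating, so that the order rises by exactly one.
      have h0 : -1 ≤ ⌊-a.re⌋ := Int.le_floor.2 (by simp at h ⊢; linarith)
      rw [e, Int.floor_add_intCast]
      omega
    have hpos : 0 < (a + m).re := by
      have h1 := Int.lt_floor_add_one (-a.re)
      have h2 : ((⌊-a.re⌋ + 1 : ℤ) : ℝ) ≤ (m : ℝ) := by
        exact_mod_cast Int.self_le_toNat _
      push_cast at h2
      simp
      linarith
    rw [whittakerReg, whittakerReg, whittakerReg, hm1, ← hm]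
    have e1 : a - 1 + ((m + 1 : ℕ) : ℂ) = a + m := by push_cast; ring
    rw [e1]
    have e2 : ∫ u in Ioi (0 : ℝ), (u : ℂ) ^ (a + m - 1) *
          iteratedDeriv (m + 1) (whittakerKernel b y) u =
        (b - 1) * (∫ u in Ioi (0 : ℝ), (u : ℂ) ^ (a + m - 1) *
          iteratedDeriv m (whittakerKernel (b - 1) y) u) -
        ∫ u in Ioi (0 : ℝ), (u : ℂ) ^ (a + m - 1) * iteratedDeriv m (whittakerKernel b y) u := by
      rw [← integral_const_mul, ← integral_sub
        ((integrableOn_cpow_mul_iteratedDeriv hpos hy m _).const_mul _)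
        (integrableOn_cpow_mul_iteratedDeriv hpos hy m _)]
      refine setIntegral_congr_fun measurableSet_Ioi fun u hu => ?_
      have hu : 0 < u := hu
      rw [iteratedDeriv_succ_whittakerKernel b (by positivity)]
      ring
    rw [e2, pow_succ]
    ring

/-! ### The Fourier transform of `(v - i x) ^ (-a) (v + i x) ^ (-b)` -/

/-- The function `(v - i x) ^ (-a)`. -/
noncomputable def linePow (a : ℂ) (v x : ℝ) : ℂ := ((v : ℂ) - I * x) ^ (-a)

/-- The function `(v - i x) ^ (-a) (v + i x) ^ (-b)`. -/
noncomputable def linePowMul (a b : ℂ) (v x : ℝ) : ℂ := linePow a v x * linePow b v (-x)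

theorem linePowMul_neg (a b : ℂ) (v x : ℝ) : linePowMul a b v (-x) = linePowMul b a v x := by
  rw [linePowMul, linePowMul, neg_neg, mul_comm]

section

variable {v : ℝ} (hv : 0 < v)
include hv

theorem sub_I_mul_mem_slitPlane (x : ℝ) : (v : ℂ) - I * x ∈ slitPlane :=
  Or.inl (by simpa using hv)

theorem sub_I_mul_ne_zero (x : ℝ) : (v : ℂ) - I * x ≠ 0 :=
  slitPlane_ne_zero (sub_I_mul_mem_slitPlane hv x)

theorem linePow_sub_one (a : ℂ) (x : ℝ) :
    linePow (a - 1) v x = (v - I * x) * linePow a v x := by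
  rw [linePow, linePow, neg_sub, sub_eq_add_neg 1 a, cpow_add _ _ (sub_I_mul_ne_zero hv x),
    cpow_one]

/-- This is `(v - i x) + (v + i x) = 2 v`; on the Fourier side it is the counterpart of
`whittakerReg_sub_one`. -/
theorem linePowMul_sub_one_add (a b : ℂ) (x : ℝ) :
    linePowMul (a - 1) b v x + linePowMul a (b - 1) v x = 2 * v * linePowMul a b v x := by
  rw [linePowMul, linePowMul, linePowMul, linePow_sub_one hv, linePow_sub_one hv]
  push_cast
  ring

theorem hasDerivAt_linePow (a : ℂ) (x : ℝ) :
    HasDerivAt (linePow a v) (I * a * linePow (a + 1) v x) x := by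
  have h1 : HasDerivAt (fun x : ℝ => (v : ℂ) - I * x) (-(I * 1)) x := by
    simpa using! ((hasDerivAt_id x).ofReal_comp.const_mul I).const_sub (v : ℂ)
  refine (h1.cpow_const_of_mem_slitPlane (-a) (sub_I_mul_mem_slitPlane hv x)).congr_deriv ?_
  rw [linePow, neg_add, ← sub_eq_add_neg]
  ring

theorem hasDerivAt_linePowMul (a b : ℂ) (x : ℝ) :
    HasDerivAt (linePowMul a b v)
      (I * a * linePowMul (a + 1) b v x - I * b * linePowMul a (b + 1) v x) x := by
  have h : HasDerivAt (fun x => linePow b v (-x)) _ x :=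
    (hasDerivAt_linePow hv b (-x)).scomp x (hasDerivAt_neg x)
  refine ((hasDerivAt_linePow hv a x).mul h).congr_deriv ?_
  simp only [linePowMul, neg_smul, one_smul]
  ring

theorem continuous_linePowMul (a b : ℂ) : Continuous (linePowMul a b v) :=
  continuous_iff_continuousAt.2 fun x => (hasDerivAt_linePowMul hv a b x).continuousAt

theorem norm_linePow_le (a : ℂ) (x : ℝ) :
    ‖linePow a v x‖ ≤ Real.exp (π * |a.im|) * (v ^ 2 + x ^ 2) ^ (-a.re / 2) := by
  have hz := sub_I_mul_ne_zero hv x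
  have hn : ‖(v : ℂ) - I * x‖ = (v ^ 2 + x ^ 2) ^ (1 / 2 : ℝ) := by
    rw [← Real.sqrt_eq_rpow, Complex.norm_def, normSq_apply]
    congr 1
    simp
    ring
  rw [linePow, norm_cpow_of_ne_zero hz, hn, ← Real.rpow_mul (by positivity), div_eq_mul_inv,
    ← Real.exp_neg, mul_comm]
  have e : (1 / 2 : ℝ) * (-a).re = -a.re / 2 := by simp; ring
  rw [e]
  gcongr
  calc -(arg (v - I * x) * (-a).im) = arg (v - I * x) * a.im := by simp
    _ ≤ |arg (v - I * x) * a.im| := le_abs_self _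
    _ = |arg (v - I * x)| * |a.im| := abs_mul _ _
    _ ≤ π * |a.im| := by gcongr; exact abs_arg_le_pi _

theorem norm_linePowMul_le (a b : ℂ) (x : ℝ) :
    ‖linePowMul a b v x‖ ≤ Real.exp (π * |a.im|) * Real.exp (π * |b.im|) *
      (v ^ 2 + x ^ 2) ^ (-(a + b).re / 2) := by
  rw [linePowMul, norm_mul]
  refine (mul_le_mul (norm_linePow_le hv a x) (norm_linePow_le hv b (-x)) (norm_nonneg _)
    (by positivity)).trans_eq ?_
  have : -(a + b).re / 2 = -a.re / 2 + -b.re / 2 := by simp; ring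
  rw [neg_sq, this, Real.rpow_add (by positivity)]
  ring

theorem integrable_linePowMul {a b : ℂ} (h : 1 < (a + b).re) :
    Integrable (linePowMul a b v) := by
  set r := (a + b).re
  have h1 : Integrable (fun x : ℝ => (1 + ‖x‖ ^ 2) ^ (-r / 2)) :=
    integrable_rpow_neg_one_add_norm_sq (by simpa using h)
  -- Chosen so that `c (1 + x ^ 2) ≤ v ^ 2 + x ^ 2`.
  set c := min 1 (v ^ 2)
  have hc : 0 < c := lt_min one_pos (by positivity)
  have h2 := h1.const_mul (Real.exp (π * |a.im|) * Real.exp (π * |b.im|) * c ^ (-r / 2))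
  refine h2.mono' (continuous_linePowMul hv a b).aestronglyMeasurable
    (Eventually.of_forall fun x => (norm_linePowMul_le hv a b x).trans ?_)
  rw [mul_assoc _ (c ^ _), ← Real.mul_rpow hc.le (by positivity)]
  gcongr ?_ * ?_
  refine Real.rpow_le_rpow_of_nonpos (by positivity) ?_ (by linarith)
  have h3 : c ≤ 1 := min_le_left _ _
  have h4 : c ≤ v ^ 2 := min_le_right _ _
  rw [Real.norm_eq_abs, sq_abs]
  nlinarith [sq_nonneg x]

theorem integrable_linePow {a : ℂ} (h : 1 < a.re) : Integrable (linePow a v) := by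
  have e : linePow a v = linePowMul a 0 v := by
    ext x
    simp [linePowMul, linePow]
  rw [e]
  exact integrable_linePowMul hv (by simpa using h)

theorem linePowMul_isBigO {a b : ℂ} (h : 0 ≤ (a + b).re) :
    linePowMul a b v =O[cocompact ℝ] fun x : ℝ => |x| ^ (-(a + b).re) := by
  refine IsBigO.of_bound (Real.exp (π * |a.im|) * Real.exp (π * |b.im|)) ?_
  have h0 : ∀ᶠ x : ℝ in cocompact ℝ, x ≠ 0 := by
    have := (isCompact_singleton (x := (0 : ℝ))).compl_mem_cocompact
    filter_upwards [this] with x hx using hx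
  filter_upwards [h0] with x hx
  refine (norm_linePowMul_le hv a b x).trans ?_
  rw [Real.norm_of_nonneg (by positivity)]
  gcongr ?_ * ?_
  have e : |x| ^ (-(a + b).re) = (x ^ 2) ^ (-(a + b).re / 2) := by
    rw [← sq_abs, ← Real.rpow_natCast, ← Real.rpow_mul (abs_nonneg x)]
    congr 1
    push_cast
    ring
  rw [e]
  exact Real.rpow_le_rpow_of_nonpos (by positivity) (by nlinarith) (by linarith)

theorem fourier_linePowMul_sub_one_add {a b : ℂ} (h : 2 < (a + b).re) (ξ : ℝ) :
    𝓕 (linePowMul (a - 1) b v) ξ + 𝓕 (linePowMul a (b - 1) v) ξ =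
      2 * v * 𝓕 (linePowMul a b v) ξ := by
  have h1 : Integrable (linePowMul (a - 1) b v) :=
    integrable_linePowMul hv (by simp at h ⊢; linarith)
  have h2 : Integrable (linePowMul a (b - 1) v) :=
    integrable_linePowMul hv (by simp at h ⊢; linarith)
  have e := congrFun (VectorFourier.fourierIntegral_add Real.continuous_fourierChar
    (L := innerₗ ℝ) (by exact continuous_inner) h1 h2) ξ
  have e2 : linePowMul (a - 1) b v + linePowMul a (b - 1) v =
      (2 * v : ℂ) • linePowMul a b v := by
    ext x
    exact linePowMul_sub_one_add hv a b x
  rw [e2, VectorFourier.fourierIntegral_const_smul] at e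
  exact e.symm

theorem fourier_linePowMul_mul {a b : ℂ} (h : 1 < (a + b).re) (ξ : ℝ) :
    2 * π * ξ * 𝓕 (linePowMul a b v) ξ =
      a * 𝓕 (linePowMul (a + 1) b v) ξ - b * 𝓕 (linePowMul a (b + 1) v) ξ := by
  have h0 : Integrable (linePowMul a b v) := integrable_linePowMul hv h
  have h1 : Integrable (linePowMul (a + 1) b v) :=
    integrable_linePowMul hv (by simp at h ⊢; linarith)
  have h2 : Integrable (linePowMul a (b + 1) v) :=
    integrable_linePowMul hv (by simp at h ⊢; linarith)
  have hd : deriv (linePowMul a b v) =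
      (I * a) • linePowMul (a + 1) b v + (-(I * b)) • linePowMul a (b + 1) v := by
    ext x
    rw [(hasDerivAt_linePowMul hv a b x).deriv]
    simp only [Pi.add_apply, Pi.smul_apply, smul_eq_mul]
    ring
  have e := congrFun (Real.fourier_deriv h0
    (fun x => (hasDerivAt_linePowMul hv a b x).differentiableAt)
    (by rw [hd]; exact (h1.smul _).add (h2.smul _))) ξ
  have e1 := congrFun (VectorFourier.fourierIntegral_add Real.continuous_fourierChar
    (L := innerₗ ℝ) (by exact continuous_inner) (h1.smul (I * a)) (h2.smul (-(I * b)))) ξ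
  rw [VectorFourier.fourierIntegral_const_smul, VectorFourier.fourierIntegral_const_smul,
    ← hd] at e1
  have e2 := e1.symm.trans e
  simp only [Pi.add_apply, Pi.smul_apply, smul_eq_mul] at e2
  change I * a * 𝓕 (linePowMul (a + 1) b v) ξ + -(I * b) * 𝓕 (linePowMul a (b + 1) v) ξ =
    2 * π * I * ξ * 𝓕 (linePowMul a b v) ξ at e2
  refine mul_left_cancel₀ I_ne_zero ?_
  linear_combination -e2

/-- Two derivatives, each again a combination of such products with larger exponents, bound the
coefficient by a constant times `1 / n ^ 2`. -/
theorem summable_fourier_linePowMul {a b : ℂ} (h : 1 < (a + b).re) :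
    Summable fun n : ℤ => ‖𝓕 (linePowMul a b v) (n : ℝ)‖ := by
  have bd : ∀ (a b : ℂ) (ξ : ℝ), ‖𝓕 (linePowMul a b v) ξ‖ ≤ ∫ x, ‖linePowMul a b v x‖ :=
    fun a b ξ => VectorFourier.norm_fourierIntegral_le_integral_norm _ _ _ _ _
  have hs := (Real.summable_one_div_int_pow (p := 2)).2 one_lt_two
  refine Summable.of_norm_bounded_eventually (hs.mul_left (‖a * (a + 1)‖ *
    (∫ x, ‖linePowMul (a + 1 + 1) b v x‖) + ‖2 * a * b‖ * (∫ x, ‖linePowMul (a + 1) (b + 1) v x‖) +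
    ‖b * (b + 1)‖ * ∫ x, ‖linePowMul a (b + 1 + 1) v x‖)) ?_
  filter_upwards [(finite_singleton (0 : ℤ)).compl_mem_cofinite] with n hn
  have hn : (0 : ℝ) < (n : ℝ) ^ 2 := by
    have : (n : ℝ) ≠ 0 := by exact_mod_cast hn
    positivity
  rw [norm_norm, mul_one_div, le_div_iff₀ hn]
  have h1 : 1 < (a + 1 + b).re := by simp at h ⊢; linarith
  have h2 : 1 < (a + (b + 1)).re := by simp at h ⊢; linarith
  have e0 := fourier_linePowMul_mul hv h n
  have e1 := fourier_linePowMul_mul hv h1 n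
  have e2 := fourier_linePowMul_mul hv h2 n
  have e : ((2 * π * n : ℝ) : ℂ) ^ 2 * 𝓕 (linePowMul a b v) (n : ℝ) =
      a * (a + 1) * 𝓕 (linePowMul (a + 1 + 1) b v) (n : ℝ) -
      2 * a * b * 𝓕 (linePowMul (a + 1) (b + 1) v) (n : ℝ) +
      b * (b + 1) * 𝓕 (linePowMul a (b + 1 + 1) v) (n : ℝ) := by
    push_cast at e0 e1 e2 ⊢
    linear_combination 2 * π * n * e0 + a * e1 - b * e2
  have e3 := congrArg norm e
  rw [norm_mul, norm_pow, norm_real, Real.norm_eq_abs, sq_abs] at e3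
  calc ‖𝓕 (linePowMul a b v) (n : ℝ)‖ * (n : ℝ) ^ 2
      ≤ (2 * π * n) ^ 2 * ‖𝓕 (linePowMul a b v) (n : ℝ)‖ := by
        rw [mul_comm, mul_pow]
        gcongr
        nlinarith [Real.pi_gt_three, mul_nonneg (sq_nonneg (n : ℝ))
          (by nlinarith [Real.pi_gt_three] : 0 ≤ (2 * π) ^ 2 - 1)]
    _ ≤ _ := by
        rw [e3]
        refine (norm_add_le _ _).trans (add_le_add ((norm_sub_le _ _).trans (add_le_add ?_ ?_)) ?_)
        all_goals
          rw [norm_mul]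
          gcongr
          exact bd _ _ _

end

/-! ### Fourier inversion for the gamma density -/

/-- The function `s ^ (a - 1) e ^ (-2 π v s)` on the positive half line, extended by zero. -/
noncomputable def gammaDensity (a : ℂ) (v : ℝ) : ℝ → ℂ :=
  indicator (Ioi 0) fun s => (s : ℂ) ^ (a - 1) * cexp (-((2 * π * v : ℝ) * s))

/-- For `Re a > 1` the density tends to zero at the origin; this continuity is what pointwise
Fourier inversion needs. -/
theorem continuous_gammaDensity {a : ℂ} (v : ℝ) (ha : 1 < a.re) :
    Continuous (gammaDensity a v) := by
  have h0 : 0 < (a - 1).re := by simpa using ha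
  have e : gammaDensity a v =
      fun s : ℝ => ((max s 0 : ℝ) : ℂ) ^ (a - 1) * cexp (-((2 * π * v : ℝ) * s)) := by
    ext s
    rcases lt_or_ge 0 s with hs | hs
    · rw [gammaDensity, indicator_of_mem (mem_Ioi.2 hs), max_eq_left hs.le]
    · have : a - 1 ≠ 0 := by intro h; simp [h] at h0
      rw [gammaDensity, indicator_of_notMem (by simpa using hs), max_eq_right hs, ofReal_zero,
        zero_cpow this, zero_mul]
  rw [e]
  exact ((continuous_ofReal_cpow_const h0).comp (continuous_id.max continuous_const)).mul
    (by fun_prop)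

theorem fourier_gammaDensity_eq_integral (a : ℂ) (v w : ℝ) :
    𝓕 (gammaDensity a v) w =
      ∫ s in Ioi (0 : ℝ), (s : ℂ) ^ (a - 1) * cexp (-(2 * π * (v + I * w) * s)) := by
  rw [Real.fourier_real_eq_integral_exp_smul, ← integral_indicator measurableSet_Ioi]
  refine integral_congr_ae (Eventually.of_forall fun s => ?_)
  by_cases hs : s ∈ Ioi (0 : ℝ)
  · simp only [gammaDensity, indicator_of_mem hs, smul_eq_mul]
    rw [mul_left_comm, ← Complex.exp_add]
    congr 2
    push_cast
    ring
  · simp [gammaDensity, indicator_of_notMem hs]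

section

variable {v : ℝ} (hv : 0 < v)
include hv

theorem integrable_gammaDensity {a : ℂ} (ha : 0 < a.re) : Integrable (gammaDensity a v) := by
  rw [gammaDensity, integrable_indicator_iff measurableSet_Ioi]
  have hc : Continuous fun s : ℝ => cexp (-((2 * π * v : ℝ) * s)) := by fun_prop
  refine mellinConvergent_of_isBigO_rpow_exp (a := 2 * π * v) (b := 0) (by positivity)
    (f := fun s : ℝ => cexp (-((2 * π * v : ℝ) * s))) ?_ ?_ ?_ ha
  · exact hc.continuousOn.locallyIntegrableOn measurableSet_Ioi
  · refine IsBigO.of_bound 1 (Eventually.of_forall fun s => ?_)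
    rw [norm_exp, ← ofReal_mul, ← ofReal_neg, ofReal_re, neg_mul]
    simp
  · simp only [neg_zero, Real.rpow_zero]
    exact (hc.continuousAt.tendsto.mono_left nhdsWithin_le_nhds).isBigO_one ℝ

theorem fourier_gammaDensity_add_one {a : ℂ} (ha : 0 < a.re) (w : ℝ) :
    2 * π * (v + I * w) * 𝓕 (gammaDensity (a + 1) v) w = a * 𝓕 (gammaDensity a v) w := by
  have ha0 : a ≠ 0 := by rintro rfl; simp at ha
  rw [fourier_gammaDensity_eq_integral, fourier_gammaDensity_eq_integral,
    add_sub_cancel_right]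
  set R : ℂ := 2 * π * (v + I * w) with hR
  have int : ∀ {a : ℂ}, 0 < a.re →
      IntegrableOn (fun s : ℝ => (s : ℂ) ^ (a - 1) * cexp (-(R * s))) (Ioi 0) := by
    intro a ha
    have h := ((integrable_gammaDensity hv ha).integrableOn (s := Ioi 0)).congr_fun
      (fun s hs => by rw [gammaDensity, indicator_of_mem hs]) measurableSet_Ioi
    have h' : IntegrableOn (fun s : ℝ => cexp (-(2 * π * I * w * s)) *
        ((s : ℂ) ^ (a - 1) * cexp (-((2 * π * v : ℝ) * s)))) (Ioi 0) := by
      refine h.bdd_mul (c := 1) (by fun_prop) (Eventually.of_forall fun s => ?_)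
      have : -(2 * π * I * w * s) = ((-(2 * π * w * s) : ℝ) : ℂ) * I := by push_cast; ring
      rw [this, norm_exp_ofReal_mul_I]
    refine h'.congr_fun (fun s _ => ?_) measurableSet_Ioi
    simp only
    rw [mul_left_comm, ← Complex.exp_add]
    congr 2
    rw [hR]
    push_cast
    ring
  have i1 := (int ha).const_mul a
  have i2 : IntegrableOn (fun s : ℝ => (s : ℂ) ^ a * cexp (-(R * s))) (Ioi 0) := by
    simpa using int (a := a + 1) (by simp; positivity)
  have i3 := i2.const_mul R
  have hd : ∀ s ∈ Ioi (0 : ℝ), HasDerivAt (fun s : ℝ => (s : ℂ) ^ a * cexp (-(R * s)))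
      (a * ((s : ℂ) ^ (a - 1) * cexp (-(R * s))) - R * ((s : ℂ) ^ a * cexp (-(R * s)))) s := by
    intro s hs
    have hs : 0 < s := hs
    have h1 := (hasDerivAt_id s).ofReal_comp.cpow_const_of_mem_slitPlane a
      (ofReal_mem_slitPlane.2 hs)
    have h2 : HasDerivAt (fun s : ℝ => cexp (-(R * s))) (cexp (-(R * s)) * (-(R * 1))) s := by
      simpa using! ((hasDerivAt_id s).ofReal_comp.const_mul R).neg.cexp
    refine (h1.mul h2).congr_deriv ?_
    simp only [id]
    push_cast
    ring
  have hi := i1.sub i3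
  have h0 := integral_Ioi_of_hasDerivAt_of_tendsto (f := fun s : ℝ =>
    (s : ℂ) ^ a * cexp (-(R * s))) ?_ hd hi
    (tendsto_zero_of_hasDerivAt_of_integrableOn_Ioi hd hi i2)
  · rw [integral_sub i1 i3, integral_const_mul, integral_const_mul] at h0
    simp only [ofReal_zero, zero_cpow ha0, zero_mul, sub_zero] at h0
    linear_combination -h0
  · refine ContinuousAt.continuousWithinAt (ContinuousAt.mul ?_ ?_)
    · exact continuousAt_ofReal_cpow_const 0 a (Or.inl ha)
    · fun_prop

theorem hasDerivAt_fourier_gammaDensity {a : ℂ} (ha : 0 < a.re) (w : ℝ) :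
    HasDerivAt (𝓕 (gammaDensity a v)) (-2 * π * I * 𝓕 (gammaDensity (a + 1) v) w) w := by
  have e : (fun x : ℝ => x • gammaDensity a v x) = gammaDensity (a + 1) v := by
    ext s
    by_cases hs : s ∈ Ioi (0 : ℝ)
    · have hs0 : (s : ℂ) ≠ 0 := ofReal_ne_zero.2 (ne_of_gt hs)
      rw [gammaDensity, gammaDensity, indicator_of_mem hs, indicator_of_mem hs, real_smul,
        ← mul_assoc]
      congr 1
      rw [cpow_sub _ _ hs0, cpow_one, add_sub_cancel_right]
      field_simp
    · simp [gammaDensity, indicator_of_notMem hs]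
  have h := Real.hasDerivAt_fourier (integrable_gammaDensity hv ha)
    (by rw [e]; exact integrable_gammaDensity hv (by simp; positivity)) w
  refine h.congr_deriv ?_
  have e2 : (fun x : ℝ => (-2 * π * I * x) • gammaDensity a v x) =
      (-2 * π * I : ℂ) • gammaDensity (a + 1) v := by
    rw [← e]
    ext x
    simp only [smul_eq_mul, Pi.smul_apply, real_smul]
    ring
  rw [e2]
  exact congrFun (VectorFourier.fourierIntegral_const_smul _ _ _ _ _) w

theorem linePow_mul_linePow_neg (a : ℂ) (x : ℝ) : linePow a v x * linePow (-a) v x = 1 := by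
  rw [linePow, linePow, ← cpow_add _ _ (sub_I_mul_ne_zero hv x), add_neg_cancel, cpow_zero]

/-- Differentiating raises `a` by one and integration by parts lowers it again, so the transform
solves a first order equation with solution `(v + i w) ^ (-a)`. The gamma integral at `w = 0` fixes
the constant. -/
theorem fourier_gammaDensity {a : ℂ} (ha : 0 < a.re) (w : ℝ) :
    𝓕 (gammaDensity a v) w = (2 * π : ℝ) ^ (-a) * Gamma a * linePow a v (-w) := by
  have hd : ∀ w : ℝ, HasDerivAt (fun w => 𝓕 (gammaDensity a v) w * linePow (-a) v (-w)) 0 w := by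
    intro w
    have h : HasDerivAt (fun w => linePow (-a) v (-w)) _ w :=
      (hasDerivAt_linePow hv (-a) (-w)).scomp w (hasDerivAt_neg w)
    refine ((hasDerivAt_fourier_gammaDensity hv ha w).mul h).congr_deriv ?_
    have e1 := linePow_sub_one hv (-a + 1) (-w)
    rw [add_sub_cancel_right] at e1
    have e2 := fourier_gammaDensity_add_one hv ha w
    simp only [neg_smul, one_smul]
    rw [e1]
    push_cast
    linear_combination -I * linePow (-a + 1) v (-w) * e2
  have hc := is_const_of_deriv_eq_zero (fun w => (hd w).differentiableAt)
    (fun w => (hd w).deriv) w 0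
  have h0 : 𝓕 (gammaDensity a v) 0 = (2 * π : ℝ) ^ (-a) * Gamma a * linePow a v (-0) := by
    rw [fourier_gammaDensity_eq_integral]
    have key := integral_cpow_mul_exp_neg_mul_Ioi ha (r := 2 * π * v) (by positivity)
    have e : ∀ s : ℝ, (2 * π * (v + I * (0 : ℝ)) * s : ℂ) = (2 * π * v : ℝ) * s := by
      intro s; push_cast; ring
    simp only [e]
    have h3 : arg ((2 * π * v : ℝ) : ℂ) ≠ π := by
      rw [arg_ofReal_of_nonneg (by positivity)]
      exact Real.pi_pos.ne
    rw [key, one_div, inv_cpow _ _ h3, ← cpow_neg, ofReal_mul,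
      mul_cpow_ofReal_nonneg (by positivity) hv.le, linePow]
    simp only [neg_zero, ofReal_zero, mul_zero, sub_zero]
    ring
  rw [h0, mul_assoc, linePow_mul_linePow_neg hv, mul_one] at hc
  rw [← hc, mul_assoc, mul_comm (linePow _ _ _), linePow_mul_linePow_neg hv, mul_one]

end

/-! ### Transforms of products: correlation integrals and continuation in the exponents -/

theorem fourier_linePowMul_neg (a b : ℂ) (v ξ : ℝ) :
    𝓕 (linePowMul a b v) (-ξ) = 𝓕 (linePowMul b a v) ξ := by
  rw [← Real.fourierInv_eq_fourier_neg, Real.fourierInv_eq_fourier_comp_neg]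
  simp only [linePowMul_neg]

section

variable {v : ℝ} (hv : 0 < v)
include hv

theorem fourier_linePow {a : ℂ} (ha : 1 < a.re) (s : ℝ) :
    (2 * π : ℝ) ^ (-a) * Gamma a * 𝓕 (linePow a v) s = gammaDensity a v s := by
  have ha0 : 0 < a.re := by linarith
  have e : 𝓕⁻ (gammaDensity a v) = ((2 * π : ℝ) ^ (-a) * Gamma a : ℂ) • linePow a v := by
    ext y
    rw [Real.fourierInv_eq_fourier_neg, fourier_gammaDensity hv ha0, neg_neg]
    rfl
  have e2 : 𝓕 (gammaDensity a v) =
      fun w => ((2 * π : ℝ) ^ (-a) * Gamma a : ℂ) * linePow a v (-w) := by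
    ext w
    exact fourier_gammaDensity hv ha0 w
  have h := congrFun ((continuous_gammaDensity v ha).fourier_fourierInv_eq
    (integrable_gammaDensity hv ha0)
    (by rw [e2]; exact ((integrable_linePow hv ha).comp_neg).const_mul _)) s
  rw [e] at h
  rw [← h]
  exact (congrFun (VectorFourier.fourierIntegral_const_smul _ _ _ _ _) s).symm

/-- The multiplication formula `∫ f̂ g = ∫ f ĝ`, with `f = (v - i x) ^ (-a)` and `g` a translated
gamma density, whose transform is `(v + i x) ^ (-b)` up to a constant and a phase. Only `f` has to
be integrable as a power, hence the asymmetric conditions on `a` and `b`. -/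
theorem fourier_linePowMul_eq_integral {a b : ℂ} (ha : 1 < a.re) (hb : 0 < b.re) (ξ : ℝ) :
    𝓕 (linePowMul a b v) ξ = (2 * π : ℝ) ^ (a + b) / (Gamma a * Gamma b) *
      ∫ s, gammaDensity a v (s + ξ) * gammaDensity b v s := by
  have ha0 : 0 < a.re := by linarith
  have hga := Gamma_ne_zero_of_re_pos ha0
  have hgb := Gamma_ne_zero_of_re_pos hb
  have h2 : ((2 * π : ℝ) : ℂ) ≠ 0 := ofReal_ne_zero.2 (by positivity)
  have hig := integrable_gammaDensity hv hb
  set g : ℝ → ℂ := fun s => gammaDensity b v (s - ξ)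
  have hF : ∀ x : ℝ, 𝓕 g x = cexp (-(2 * π * x * ξ) * I) * 𝓕 (gammaDensity b v) x := by
    intro x
    rw [Real.fourier_real_eq_integral_exp_smul, Real.fourier_real_eq_integral_exp_smul,
      ← integral_const_mul, ← integral_add_right_eq_self _ ξ]
    refine integral_congr_ae (Eventually.of_forall fun s => ?_)
    simp only [g, smul_eq_mul, add_sub_cancel_right]
    rw [← mul_assoc, ← Complex.exp_add]
    congr 2
    push_cast
    ring
  have e : ((2 * π : ℝ) ^ (-b) * Gamma b : ℂ) * 𝓕 (linePowMul a b v) ξ =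
      ∫ x, linePow a v x * 𝓕 g x := by
    rw [Real.fourier_real_eq_integral_exp_smul, ← integral_const_mul]
    refine integral_congr_ae (Eventually.of_forall fun x => ?_)
    simp only [hF, fourier_gammaDensity hv hb, linePowMul, smul_eq_mul]
    have : ((-2 * π * x * ξ : ℝ) : ℂ) = -(2 * π * x * ξ) := by push_cast; ring
    rw [this]
    ring
  have hm := VectorFourier.integral_fourierIntegral_smul_eq_flip (L := innerₗ ℝ)
    Real.continuous_fourierChar (by exact continuous_inner) (integrable_linePow hv ha)
    (hig.comp_sub_right ξ)
  rw [flip_innerₗ] at hm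
  have hm' : ∫ s, 𝓕 (linePow a v) s * g s = ∫ x, linePow a v x * 𝓕 g x := hm
  have e3 : ((2 * π : ℝ) ^ (-a) * Gamma a : ℂ) * ∫ s, 𝓕 (linePow a v) s * g s =
      ∫ s, gammaDensity a v (s + ξ) * gammaDensity b v s := by
    rw [← integral_const_mul, ← integral_add_right_eq_self _ ξ]
    refine integral_congr_ae (Eventually.of_forall fun s => ?_)
    simp only [g, add_sub_cancel_right]
    rw [← mul_assoc, fourier_linePow hv ha]
  rw [← e3, hm', ← e, cpow_add _ _ h2, cpow_neg, cpow_neg]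
  have h3 := (cpow_ne_zero_iff_of_exponent_ne_zero (x := ((2 * π : ℝ) : ℂ)) (y := a)
    (by rintro rfl; simp at ha0)).2 h2
  have h4 := (cpow_ne_zero_iff_of_exponent_ne_zero (x := ((2 * π : ℝ) : ℂ)) (y := b)
    (by rintro rfl; simp at hb)).2 h2
  field_simp

/-- The integral of two gamma densities, the first one shifted to the left. -/
theorem integral_gammaDensity_add_mul (a : ℂ) {b : ℂ} (hb : 0 < b.re) {ξ : ℝ} (hξ : 0 < ξ) :
    ∫ s, gammaDensity a v (s + ξ) * gammaDensity b v s =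
      (4 * π * v : ℝ) ^ (1 - (a + b)) * cexp (-(2 * π * v * ξ)) *
        (Gamma b * whittakerReg b a (4 * π * v * ξ)) := by
  have hgb := Gamma_ne_zero_of_re_pos hb
  set c := 4 * π * v with hc
  have hc0 : 0 < c := by positivity
  have hc1 : (c : ℂ) ≠ 0 := ofReal_ne_zero.2 hc0.ne'
  rw [whittakerReg_of_re_pos hb, mul_inv_cancel_left₀ hgb]
  -- Prepares the substitution `u = 4 π v s`, which turns the joint decay into `e ^ (-u)`; one of
  -- the powers of `c` is later absorbed by `du`.
  have e : ∫ s, gammaDensity a v (s + ξ) * gammaDensity b v s =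
      ∫ s in Ioi (0 : ℝ), (c : ℂ) ^ (2 - (a + b)) * cexp (-(2 * π * v * ξ)) *
        (((c * s : ℝ) : ℂ) ^ (b - 1) * whittakerKernel a (c * ξ) (c * s)) := by
    rw [← integral_indicator measurableSet_Ioi]
    refine integral_congr_ae (Eventually.of_forall fun s => ?_)
    by_cases hs : s ∈ Ioi (0 : ℝ)
    · have hs0 : 0 < s := hs
      have hs1 : 0 < s + ξ := by positivity
      simp only [gammaDensity, indicator_of_mem hs, indicator_of_mem (mem_Ioi.2 hs1),
        whittakerKernel]
      rw [← mul_add, ofReal_mul c s, ofReal_mul c (s + ξ), mul_cpow_ofReal_nonneg hc0.le hs0.le,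
        mul_cpow_ofReal_nonneg hc0.le hs1.le]
      have e1 : (2 : ℂ) - (a + b) = -((b - 1) + (a - 1)) := by ring
      have e2 : cexp (-((2 * π * v : ℝ) * (s + ξ : ℝ))) * cexp (-((2 * π * v : ℝ) * s)) =
          cexp (-(2 * π * v * ξ)) * cexp (-(c * s)) := by
        rw [← Complex.exp_add, ← Complex.exp_add, hc]
        congr 1
        push_cast
        ring
      have e3 : (c : ℂ) ^ (-((b - 1) + (a - 1))) * ((c : ℂ) ^ (b - 1) * (c : ℂ) ^ (a - 1)) = 1 := by
        rw [← cpow_add _ _ hc1, ← cpow_add _ _ hc1, neg_add_cancel, cpow_zero]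
      rw [e1]
      linear_combination (s : ℂ) ^ (b - 1) * ((s + ξ : ℝ) : ℂ) ^ (a - 1) * e2 -
        (s : ℂ) ^ (b - 1) * ((s + ξ : ℝ) : ℂ) ^ (a - 1) * cexp (-(2 * π * v * ξ)) *
          cexp (-(c * s)) * e3
    · simp [gammaDensity, indicator_of_notMem hs]
  rw [e, integral_const_mul, integral_comp_mul_left_Ioi
    (fun u : ℝ => (u : ℂ) ^ (b - 1) * whittakerKernel a (c * ξ) u) 0 hc0, mul_zero, real_smul,
    show (2 : ℂ) - (a + b) = 1 + (1 - (a + b)) by ring, cpow_add _ _ hc1, cpow_one]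
  push_cast
  field_simp

theorem integral_gammaDensity_mul {a b : ℂ} (hab : 1 < (a + b).re) :
    ∫ s, gammaDensity a v s * gammaDensity b v s =
      (4 * π * v : ℝ) ^ (1 - (a + b)) * Gamma (a + b - 1) := by
  have key := integral_cpow_mul_exp_neg_mul_Ioi (a := a + b - 1) (by simp at hab ⊢; linarith)
    (r := 4 * π * v) (by positivity)
  have h3 : arg ((4 * π * v : ℝ) : ℂ) ≠ π := by
    rw [arg_ofReal_of_nonneg (by positivity)]
    exact Real.pi_pos.ne
  rw [one_div, inv_cpow _ _ h3, ← cpow_neg, neg_sub] at key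
  rw [← key, ← integral_indicator measurableSet_Ioi]
  refine integral_congr_ae (Eventually.of_forall fun s => ?_)
  by_cases hs : s ∈ Ioi (0 : ℝ)
  · have hs0 : (s : ℂ) ≠ 0 := ofReal_ne_zero.2 (ne_of_gt hs)
    simp only [gammaDensity, indicator_of_mem hs]
    rw [mul_mul_mul_comm, ← cpow_add _ _ hs0, ← Complex.exp_add]
    congr 2
    · ring
    · push_cast
      ring
  · simp [gammaDensity, indicator_of_notMem hs]

theorem two_pi_cpow_mul_cpow (q : ℂ) :
    ((2 * π : ℝ) : ℂ) ^ q * ((4 * π * v : ℝ) : ℂ) ^ (1 - q) =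
    2 * π * ((2 * v : ℝ) : ℂ) ^ (1 - q) := by
  have h2 : ((2 * π : ℝ) : ℂ) ≠ 0 := ofReal_ne_zero.2 (by positivity)
  rw [show 4 * π * v = (2 * π) * (2 * v) by ring, ofReal_mul (2 * π) (2 * v),
    mul_cpow_ofReal_nonneg (by positivity) (by positivity), ← mul_assoc, ← cpow_add _ _ h2,
    add_sub_cancel, cpow_one]
  push_cast
  ring

theorem two_mul_cpow_one_sub (a b : ℂ) :
    (2 * v : ℝ) ^ (1 - (a + b)) * (2 * v) = ((2 * v : ℝ) : ℂ) ^ (1 - (a - 1 + b)) := by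
  have hv0 : ((2 * v : ℝ) : ℂ) ≠ 0 := ofReal_ne_zero.2 (by positivity)
  rw [show 1 - (a - 1 + b) = 1 - (a + b) + 1 by ring, cpow_add _ _ hv0, cpow_one]
  push_cast
  rfl

/-- The Fourier transform of `(v - i x) ^ (-a) (v + i x) ^ (-b)` at a positive frequency. -/
theorem fourier_linePowMul_of_pos {a b : ℂ} (hab : 2 < (a + b).re) {ξ : ℝ} (hξ : 0 < ξ) :
    𝓕 (linePowMul a b v) ξ = 2 * π * (2 * v : ℝ) ^ (1 - (a + b)) * cexp (-(2 * π * v * ξ)) *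
      (whittakerReg b a (4 * π * v * ξ) / Gamma a) := by
  have hy : 0 < 4 * π * v * ξ := by positivity
  have hv0 : ((2 * v : ℝ) : ℂ) ≠ 0 := ofReal_ne_zero.2 (by positivity)
  have base : ∀ a b : ℂ, 2 < (a + b).re → 0 < a.re → 0 < b.re →
      𝓕 (linePowMul a b v) ξ = 2 * π * (2 * v : ℝ) ^ (1 - (a + b)) * cexp (-(2 * π * v * ξ)) *
      (whittakerReg b a (4 * π * v * ξ) / Gamma a) := by
    intro a b hab ha hb
    have hgb := Gamma_ne_zero_of_re_pos hb
    have main : 𝓕 (linePowMul a b v) ξ = (2 * π : ℝ) ^ (a + b) / (Gamma a * Gamma b) *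
        ∫ s, gammaDensity a v (s + ξ) * gammaDensity b v s := by
      -- Since `Re (a + b) > 2`, at least one exponent has real part above `1`; if it is `b`,
      -- reflect and translate.
      by_cases ha1 : 1 < a.re
      · exact fourier_linePowMul_eq_integral hv ha1 hb ξ
      · have hb1 : 1 < b.re := by simp at hab; linarith
        rw [← fourier_linePowMul_neg, fourier_linePowMul_eq_integral hv hb1 ha,
          ← integral_add_right_eq_self _ ξ, add_comm b a, mul_comm (Gamma b)]
        simp only [add_neg_cancel_right]
        congr 2
        ext s
        ring
    rw [main, integral_gammaDensity_add_mul hv a hb hξ, ← two_pi_cpow_mul_cpow hv]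
    field_simp
  -- Induction on how far `Re b` lies below zero. The relation at `(a, b + 1)` yields `(a, b)` from
  -- `(a, b + 1)` and `(a - 1, b + 1)`. As `Re b ≤ 0` forces `Re a > 2`, the exponent `a - 1` keeps
  -- positive real part.
  have left : ∀ n : ℕ, ∀ a b : ℂ, 2 < (a + b).re → 0 < a.re → -n < b.re →
      𝓕 (linePowMul a b v) ξ = 2 * π * (2 * v : ℝ) ^ (1 - (a + b)) * cexp (-(2 * π * v * ξ)) *
      (whittakerReg b a (4 * π * v * ξ) / Gamma a) := by
    intro n
    induction n with
    | zero => exact fun a b h h1 h2 => base a b h h1 (by simpa using h2)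
    | succ n ih =>
      intro a b hab ha hb
      by_cases hb0 : 0 < b.re
      · exact base a b hab ha hb0
      push Not at hb0
      push_cast at hb
      simp only [add_re] at hab
      have h1 := ih a (b + 1) (by simp; linarith) ha (by simp; linarith)
      have h2 := ih (a - 1) (b + 1) (by simp; linarith) (by simp; linarith) (by simp; linarith)
      have h3 := fourier_linePowMul_sub_one_add hv (a := a) (b := b + 1) (by simp; linarith) ξ
      rw [h1, h2, add_sub_cancel_right] at h3
      have h4 := whittakerReg_sub_one (b + 1) a hy
      rw [add_sub_cancel_right] at h4
      have h5 := one_div_Gamma_eq_self_mul_one_div_Gamma_add_one (a - 1)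
      rw [sub_add_cancel] at h5
      have s1 := two_mul_cpow_one_sub hv a (b + 1)
      rw [show a - 1 + (b + 1) = a + b by ring] at s1 h3
      rw [h4]
      rw [div_eq_mul_inv, div_eq_mul_inv, h5] at h3
      rw [div_eq_mul_inv]
      linear_combination h3 + 2 * π * cexp (-(2 * π * v * ξ)) * (Gamma a)⁻¹ *
        whittakerReg (b + 1) a (4 * π * v * ξ) * s1
  have right : ∀ n : ℕ, ∀ a b : ℂ, 2 < (a + b).re → -n < a.re → 0 < b.re →
      𝓕 (linePowMul a b v) ξ = 2 * π * (2 * v : ℝ) ^ (1 - (a + b)) * cexp (-(2 * π * v * ξ)) *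
      (whittakerReg b a (4 * π * v * ξ) / Gamma a) := by
    intro n
    induction n with
    | zero => exact fun a b h h1 h2 => base a b h (by simpa using h1) h2
    | succ n ih =>
      intro a b hab ha hb
      by_cases ha0 : 0 < a.re
      · exact base a b hab ha0 hb
      push Not at ha0
      push_cast at ha
      simp only [add_re] at hab
      have h1 := ih (a + 1) b (by simp; linarith) (by simp; linarith) hb
      have h2 := ih (a + 1) (b - 1) (by simp; linarith) (by simp; linarith) (by simp; linarith)
      have h3 := fourier_linePowMul_sub_one_add hv (a := a + 1) (b := b) (by simp; linarith) ξ
      rw [h1, h2, add_sub_cancel_right] at h3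
      have h4 := whittakerReg_sub_one b (a + 1) hy
      rw [add_sub_cancel_right] at h4
      have h5 := one_div_Gamma_eq_self_mul_one_div_Gamma_add_one a
      have s1 := two_mul_cpow_one_sub hv (a + 1) b
      rw [add_sub_cancel_right] at s1
      rw [show a + 1 + (b - 1) = a + b by ring, h4] at h3
      rw [div_eq_mul_inv, div_eq_mul_inv] at h3
      rw [div_eq_mul_inv, h5]
      linear_combination h3 + 2 * π * cexp (-(2 * π * v * ξ)) * (Gamma (a + 1))⁻¹ *
        whittakerReg b (a + 1) (4 * π * v * ξ) * s1
  by_cases ha : 0 < a.re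
  · obtain ⟨n, hn⟩ := exists_nat_gt (-b.re)
    exact left n a b hab ha (by linarith)
  · obtain ⟨n, hn⟩ := exists_nat_gt (-a.re)
    exact right n a b hab (by linarith) (by simp at hab; linarith)

theorem fourier_linePowMul_zero {a b : ℂ} (hab : 2 < (a + b).re) :
    𝓕 (linePowMul a b v) 0 = 2 * π * (2 * v : ℝ) ^ (1 - (a + b)) *
      (Gamma (a + b - 1) / (Gamma a * Gamma b)) := by
  have base : ∀ a b : ℂ, 2 < (a + b).re → 0 < a.re → 0 < b.re →
      𝓕 (linePowMul a b v) 0 = 2 * π * (2 * v : ℝ) ^ (1 - (a + b)) *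
        (Gamma (a + b - 1) / (Gamma a * Gamma b)) := by
    have h1 : ∀ a b : ℂ, 2 < (a + b).re → 1 < a.re → 0 < b.re →
        𝓕 (linePowMul a b v) 0 = 2 * π * (2 * v : ℝ) ^ (1 - (a + b)) *
          (Gamma (a + b - 1) / (Gamma a * Gamma b)) := by
      intro a b hab ha hb
      rw [fourier_linePowMul_eq_integral hv ha hb]
      simp only [add_zero]
      rw [integral_gammaDensity_mul hv (by linarith), ← two_pi_cpow_mul_cpow hv]
      ring
    intro a b hab ha hb
    by_cases ha1 : 1 < a.re
    · exact h1 a b hab ha1 hb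
    · rw [← neg_zero, fourier_linePowMul_neg, add_comm a b, mul_comm (Gamma a)]
      exact h1 b a (by rwa [add_comm]) (by simp at hab; linarith) ha
  have left : ∀ n : ℕ, ∀ a b : ℂ, 2 < (a + b).re → 0 < a.re → -n < b.re →
      𝓕 (linePowMul a b v) 0 = 2 * π * (2 * v : ℝ) ^ (1 - (a + b)) *
        (Gamma (a + b - 1) / (Gamma a * Gamma b)) := by
    intro n
    induction n with
    | zero => exact fun a b h h1 h2 => base a b h h1 (by simpa using h2)
    | succ n ih =>
      intro a b hab ha hb
      by_cases hb0 : 0 < b.re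
      · exact base a b hab ha hb0
      push Not at hb0
      push_cast at hb
      simp only [add_re] at hab
      have h1 := ih a (b + 1) (by simp; linarith) ha (by simp; linarith)
      have h2 := ih (a - 1) (b + 1) (by simp; linarith) (by simp; linarith) (by simp; linarith)
      have h3 := fourier_linePowMul_sub_one_add hv (a := a) (b := b + 1) (by simp; linarith) 0
      rw [h1, h2, add_sub_cancel_right] at h3
      have h5 := one_div_Gamma_eq_self_mul_one_div_Gamma_add_one (a - 1)
      have h6 := one_div_Gamma_eq_self_mul_one_div_Gamma_add_one b
      -- With the recurrences of the reciprocal gamma factors, the contiguous relation comes down to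
      -- `(a - 1) + b = a + b - 1`.
      have h7 : Gamma (a + b) = (a + b - 1) * Gamma (a + b - 1) := by
        rw [← Gamma_add_one _ (by intro h; have := congrArg re h; simp at this; linarith),
          sub_add_cancel]
      rw [sub_add_cancel] at h5
      have s1 := two_mul_cpow_one_sub hv a (b + 1)
      rw [show a - 1 + (b + 1) = a + b by ring] at s1 h3
      rw [show a + (b + 1) - 1 = a + b by ring, h7] at h3
      rw [div_eq_mul_inv, mul_inv, div_eq_mul_inv, mul_inv, h5] at h3
      rw [div_eq_mul_inv, mul_inv, h6]
      linear_combination h3 + 2 * π * (a + b - 1) * Gamma (a + b - 1) * (Gamma a)⁻¹ *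
        (Gamma (b + 1))⁻¹ * s1
  by_cases ha : 0 < a.re
  · obtain ⟨n, hn⟩ := exists_nat_gt (-b.re)
    exact left n a b hab ha (by linarith)
  · obtain ⟨n, hn⟩ := exists_nat_gt (-a.re)
    rw [← neg_zero, fourier_linePowMul_neg, add_comm a b, mul_comm (Gamma a)]
    exact left n b a (by rwa [add_comm]) (by simp at hab; linarith) (by linarith)

theorem tsum_linePowMul_add_int {a b : ℂ} (hab : 1 < (a + b).re) (x : ℝ) :
    ∑' n : ℤ, linePowMul a b v (x + n) =
      ∑' n : ℤ, 𝓕 (linePowMul a b v) (n : ℝ) * cexp (2 * π * I * n * x) := by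
  rw [Real.tsum_eq_tsum_fourier_of_rpow_decay_of_summable (continuous_linePowMul hv a b) hab
    (linePowMul_isBigO hv (by linarith)) (summable_fourier_linePowMul hv hab).of_norm]
  simp

end

/-! ### Ramanujan sums -/

theorem ramanujanG_eq_sum_primitiveRoots (b : ℤ) {n : ℕ} (hn : n ≠ 0) :
    ramanujanG b n = ∑ ζ ∈ primitiveRoots n ℂ, ζ ^ b := by
  have hz := isPrimitiveRoot_exp n hn
  have e : ∀ a : ℕ, cexp (2 * π * I * a / n) = cexp (2 * π * I / n) ^ a := by
    intro a
    rw [← Complex.exp_nat_mul]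
    congr 1
    ring
  simp only [ramanujanG, e]
  refine Finset.sum_bij (fun a _ => cexp (2 * π * I / n) ^ a) ?_ ?_ ?_ (fun _ _ => rfl)
  · intro a ha
    rw [mem_primitiveRoots (Nat.pos_of_ne_zero hn)]
    exact hz.pow_of_coprime a (Finset.mem_filter.1 ha).2
  · intro a ha b hb h
    simp only [Finset.mem_filter, Finset.mem_range] at ha hb
    exact hz.pow_inj ha.1 hb.1 h
  · intro ζ hζ
    rw [mem_primitiveRoots (Nat.pos_of_ne_zero hn)] at hζ
    obtain ⟨i, hi, hc, rfl⟩ := haveI : NeZero n := ⟨hn⟩; hz.isPrimitiveRoot_iff.1 hζ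
    exact ⟨i, Finset.mem_filter.2 ⟨Finset.mem_range.2 hi, hc⟩, rfl⟩

theorem ramanujanG_one (b : ℤ) : ramanujanG b 1 = 1 := by
  simp [ramanujanG_eq_sum_primitiveRoots]

theorem norm_ramanujanG_le (b : ℤ) (n : ℕ) : ‖ramanujanG b n‖ ≤ n := by
  have h : ∀ a : ℕ, ‖cexp (2 * π * I * a / n) ^ b‖ = 1 := by
    intro a
    have : 2 * π * I * a / n = ((2 * π * a / n : ℝ) : ℂ) * I := by push_cast; ring
    rw [norm_zpow, this, norm_exp_ofReal_mul_I, one_zpow]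
  refine (norm_sum_le _ _).trans ?_
  simp only [h, Finset.sum_const, nsmul_eq_mul, mul_one]
  exact_mod_cast (Finset.card_filter_le _ _).trans (Finset.card_range n).le

/-- Products of primitive roots of coprime orders enumerate the primitive `m n`-th roots: a
coincidence would give a quotient of order dividing both `m` and `n`, and the totients show that
none is missed. -/
theorem ramanujanG_mul (b : ℤ) {m n : ℕ} (hm : m ≠ 0) (hn : n ≠ 0) (h : m.Coprime n) :
    ramanujanG b (m * n) = ramanujanG b m * ramanujanG b n := by
  have hm0 := Nat.pos_of_ne_zero hm
  have hn0 := Nat.pos_of_ne_zero hn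
  have inj : Set.InjOn (fun p : ℂ × ℂ => p.1 * p.2)
      (primitiveRoots m ℂ ×ˢ primitiveRoots n ℂ : Finset (ℂ × ℂ)) := by
    rintro ⟨x, y⟩ hxy ⟨x', y'⟩ hxy' e
    simp only [Finset.coe_product, Set.mem_prod, Finset.mem_coe, mem_primitiveRoots hm0,
      mem_primitiveRoots hn0] at hxy hxy' e
    have hx' := hxy'.1.ne_zero hm
    have hy := hxy.2.ne_zero hn
    have h1 : x / x' = y' / y := by rw [div_eq_div_iff hx' hy, e, mul_comm]
    have h2 : (x / x') ^ m = 1 := by rw [div_pow, hxy.1.pow_eq_one, hxy'.1.pow_eq_one, div_one]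
    have h3 : (x / x') ^ n = 1 := by
      rw [h1, div_pow, hxy.2.pow_eq_one, hxy'.2.pow_eq_one, div_one]
    have h4 : x / x' = 1 := by
      have := orderOf_dvd_of_pow_eq_one h2
      have h' := orderOf_dvd_of_pow_eq_one h3
      exact orderOf_eq_one_iff.1 (Nat.eq_one_of_dvd_coprimes h this h')
    exact Prod.ext ((div_eq_one_iff_eq hx').1 h4) ((div_eq_one_iff_eq hy).1 (h1 ▸ h4)).symm
  have im : (primitiveRoots m ℂ ×ˢ primitiveRoots n ℂ).image (fun p : ℂ × ℂ => p.1 * p.2) =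
      primitiveRoots (m * n) ℂ := by
    refine Finset.eq_of_subset_of_card_le ?_ ?_
    · intro z hz
      obtain ⟨⟨x, y⟩, hxy, rfl⟩ := Finset.mem_image.1 hz
      rw [Finset.mem_product, mem_primitiveRoots hm0, mem_primitiveRoots hn0] at hxy
      rw [mem_primitiveRoots (Nat.mul_pos hm0 hn0), IsPrimitiveRoot.iff_orderOf]
      rw [(Commute.all x y).orderOf_mul_eq_mul_orderOf_of_coprime, ← hxy.1.eq_orderOf,
        ← hxy.2.eq_orderOf]
      rwa [← hxy.1.eq_orderOf, ← hxy.2.eq_orderOf]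
    · rw [Finset.card_image_of_injOn inj, Finset.card_product,
        (isPrimitiveRoot_exp m hm).card_primitiveRoots,
        (isPrimitiveRoot_exp n hn).card_primitiveRoots,
        (isPrimitiveRoot_exp (m * n) (mul_ne_zero hm hn)).card_primitiveRoots,
        Nat.totient_mul h]
  rw [ramanujanG_eq_sum_primitiveRoots b hm, ramanujanG_eq_sum_primitiveRoots b hn,
    ramanujanG_eq_sum_primitiveRoots b (mul_ne_zero hm hn), ← im, Finset.sum_image inj,
    Finset.sum_mul_sum, Finset.sum_product]
  simp only [mul_zpow]

theorem lseriesSummable_ramanujanG_mul (N : ℕ) (b : ℤ) {s : ℂ} (hs : 2 < s.re) :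
    LSeriesSummable (fun m => ramanujanG b (N * m)) s := by
  refine LSeriesSummable_of_le_const_mul_rpow hs ⟨N, fun n _ => ?_⟩
  refine (norm_ramanujanG_le b (N * n)).trans_eq ?_
  push_cast
  norm_num

theorem lseriesSummable_ramanujanG (b : ℤ) {s : ℂ} (hs : 2 < s.re) :
    LSeriesSummable (ramanujanG b) s := by
  simpa using lseriesSummable_ramanujanG_mul 1 b hs

theorem term_ramanujanG_prime_pow (b : ℤ) (s : ℂ) {p : ℕ} (hp : p.Prime) (e : ℕ) :
    LSeries.term (ramanujanG b) s (p ^ e) = ramanujanG b (p ^ e) / (p : ℂ) ^ ((e : ℂ) * s) := by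
  rw [LSeries.term_of_ne_zero (pow_ne_zero _ hp.ne_zero), natCast_cpow_natCast_mul, Nat.cast_pow]

theorem summable_term_prime_pow {f : ℕ → ℂ} {s : ℂ} (hf : LSeriesSummable f s) {p : ℕ}
    (hp : p.Prime) : Summable fun e : ℕ => LSeries.term f s (p ^ e) :=
  hf.comp_injective (Nat.pow_right_injective hp.two_le)

/-- The leading term `1` dominates: the tail is at most `r / (1 - r) < 1` with `r = p ^ (1 - Re s) <
1 / 2`. -/
theorem tsum_ramanujanG_prime_pow_ne_zero (b : ℤ) {s : ℂ} (hs : 2 < s.re) {p : ℕ}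
    (hp : p.Prime) : ∑' e : ℕ, LSeries.term (ramanujanG b) s (p ^ e) ≠ 0 := by
  have hsum := summable_term_prime_pow (lseriesSummable_ramanujanG b hs) hp
  have hp0 : (0 : ℝ) < p := by exact_mod_cast hp.pos
  have hp2 : (2 : ℝ) ≤ p := by exact_mod_cast hp.two_le
  set r : ℝ := (p : ℝ) ^ (1 - s.re) with hr
  have hr0 : 0 < r := by positivity
  have hr2 : r < 1 / 2 := by
    calc r < (p : ℝ) ^ (-1 : ℝ) := Real.rpow_lt_rpow_of_exponent_lt (by linarith) (by linarith)
      _ = 1 / p := by rw [Real.rpow_neg_one, one_div]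
      _ ≤ 1 / 2 := by gcongr
  have hle : ∀ e : ℕ, ‖LSeries.term (ramanujanG b) s (p ^ (e + 1))‖ ≤ r * r ^ e := by
    intro e
    rw [LSeries.norm_term_eq, if_neg (pow_ne_zero _ hp.ne_zero), ← pow_succ',
      div_le_iff₀ (by have := hp.pos; positivity)]
    refine (norm_ramanujanG_le _ _).trans_eq ?_
    rw [hr, ← Real.rpow_natCast, ← Real.rpow_mul hp0.le, Nat.cast_pow, ← Real.rpow_natCast,
      ← Real.rpow_mul hp0.le, ← Real.rpow_add hp0]
    congr 1
    ring
  have hgeo : HasSum (fun e : ℕ => r * r ^ e) (r * (1 - r)⁻¹) :=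
    (hasSum_geometric_of_lt_one hr0.le (by linarith)).mul_left r
  have hb := tsum_of_norm_bounded hgeo hle
  have hlt : r * (1 - r)⁻¹ < 1 := by
    rw [← div_eq_mul_inv, div_lt_one (by linarith)]
    linarith
  intro h0
  rw [hsum.tsum_eq_zero_add, pow_zero, LSeries.term_of_ne_zero one_ne_zero, ramanujanG_one,
    Nat.cast_one, one_cpow, div_one] at h0
  rw [eq_neg_of_add_eq_zero_right h0, norm_neg, norm_one] at hb
  linarith

theorem ramanujanLLocal_eq_prod (N : ℕ) (b : ℤ) (s : ℂ) :
    ramanujanLLocal N b s =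
      ∏ p ∈ N.primeFactors, ∑' e : ℕ, LSeries.term (ramanujanG b) s (p ^ e) := by
  refine Finset.prod_congr rfl fun p hp => tsum_congr fun e => ?_
  rw [term_ramanujanG_prime_pow b s (Nat.prime_of_mem_primeFactors hp)]

theorem ramanujanLLocal_ne_zero (N : ℕ) (b : ℤ) {s : ℂ} (hs : 2 < s.re) :
    ramanujanLLocal N b s ≠ 0 := by
  rw [ramanujanLLocal_eq_prod]
  exact Finset.prod_ne_zero_iff.2 fun p hp =>
    tsum_ramanujanG_prime_pow_ne_zero b hs (Nat.prime_of_mem_primeFactors hp)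

theorem term_ramanujanG_mul (b : ℤ) (s : ℂ) {m n : ℕ} (h : m.Coprime n) :
    LSeries.term (ramanujanG b) s (m * n) =
      LSeries.term (ramanujanG b) s m * LSeries.term (ramanujanG b) s n := by
  rcases eq_or_ne m 0 with rfl | hm
  · simp
  rcases eq_or_ne n 0 with rfl | hn
  · simp
  rw [LSeries.term_of_ne_zero hm, LSeries.term_of_ne_zero hn,
    LSeries.term_of_ne_zero (mul_ne_zero hm hn), ramanujanG_mul b hm hn h, Nat.cast_mul,
    natCast_mul_natCast_cpow, div_mul_div_comm]

/-- Removing the Euler factors at the primes dividing `N`. -/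
theorem tsum_coprime_ramanujanG {N : ℕ} (hN : N ≠ 0) (b : ℤ) {s : ℂ} (hs : 2 < s.re) :
    ∑' m : ℕ, (if m.Coprime N then LSeries.term (ramanujanG b) s m else 0) =
      ramanujanL b s / ramanujanLLocal N b s := by
  rw [eq_div_iff (ramanujanLLocal_ne_zero N b hs), ramanujanLLocal_eq_prod]
  set f := LSeries.term (ramanujanG b) s with hf
  have hsum : Summable f := lseriesSummable_ramanujanG b hs
  have f1 : f 1 = 1 := by
    rw [hf, LSeries.term_of_ne_zero one_ne_zero, ramanujanG_one]
    simp
  have P := EulerProduct.eulerProduct_hasProd f1 (term_ramanujanG_mul b s) hsum.norm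
    (LSeries.term_zero _ _)
  -- The truncated series has local factor `1` at the primes dividing `N` and the full factor
  -- elsewhere.
  have Q := EulerProduct.eulerProduct_hasProd (R := ℂ)
    (f := fun m => if m.Coprime N then f m else 0) (by simp [f1])
    (by
      intro m n h
      simp only [Nat.coprime_mul_iff_left, hf, term_ramanujanG_mul b s h]
      split_ifs <;> simp_all)
    (hsum.norm.of_nonneg_of_le (fun _ => norm_nonneg _)
      (fun m => by split_ifs <;> simp))
    (by simp [hf])
  set t : Finset Nat.Primes := 
    N.primeFactors.preimage (fun p : Nat.Primes => (p : ℕ)) Subtype.val_injective.injOn with ht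
  have mem : ∀ p : Nat.Primes, p ∈ t ↔ (p : ℕ) ∣ N := fun p =>
    Finset.mem_preimage.trans (Nat.mem_primeFactors.trans
      ⟨fun h => h.2.1, fun h => ⟨p.2, h, hN⟩⟩)
  -- The finite product is spread over all primes, so that `Q` times `R` matches `P` factor by
  -- factor.
  have R : HasProd (fun p : Nat.Primes => if p ∈ t then ∑' e : ℕ, f ((p : ℕ) ^ e) else 1)
      (∏ p ∈ t, ∑' e : ℕ, f ((p : ℕ) ^ e)) := by
    rw [← Finset.prod_congr rfl (fun p hp => if_pos hp)]
    exact hasProd_prod_of_ne_finset_one fun p hp => if_neg hp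
  have e1 : ∏ p ∈ t, ∑' e : ℕ, f ((p : ℕ) ^ e) = ∏ p ∈ N.primeFactors, ∑' e : ℕ, f (p ^ e) := by
    exact Finset.prod_preimage _ _ _ (fun p => ∑' e : ℕ, f (p ^ e)) fun p hp h =>
      (h ⟨⟨p, Nat.prime_of_mem_primeFactors hp⟩, rfl⟩).elim
  rw [e1] at R
  refine (Q.mul R).unique ?_
  rw [ramanujanL, LSeries]
  convert! P using 2 with p
  have hp := p.2
  by_cases hpN : (p : ℕ) ∣ N
  · rw [if_pos ((mem p).2 hpN)]
    have : ∑' e : ℕ, (if ((p : ℕ) ^ e).Coprime N then f ((p : ℕ) ^ e) else 0) = 1 := by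
      rw [tsum_eq_single 0]
      · simp [f1]
      · intro e he
        rw [if_neg]
        rw [Nat.coprime_pow_left_iff (Nat.pos_of_ne_zero he), hp.coprime_iff_not_dvd]
        simpa using hpN
    rw [this, one_mul]
  · have hpt : p ∉ t := fun h => hpN ((mem p).1 h)
    have hc : ∀ e : ℕ, ((p : ℕ) ^ e).Coprime N := fun e =>
      Nat.Coprime.pow_left e (hp.coprime_iff_not_dvd.2 hpN)
    rw [if_neg hpt, mul_one]
    exact tsum_congr fun e => if_pos (hc e)

/-! ### The summands -/

/-- The sum of `log w` and its conjugate is real, so the branch enters only through the integral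
power `w ^ k`. -/
theorem conjPow_eq {w a b : ℂ} (hw : w ≠ 0) {k : ℤ} (h : a - b = k) :
    conjPow w a b = cexp (2 * b * Real.log ‖w‖) * w ^ k := by
  have e : log w + (starRingEnd ℂ) (log w) = 2 * (Real.log ‖w‖ : ℝ) := by
    rw [add_conj, log_re]
    push_cast
    rfl
  have e2 : w ^ k = cexp (k * log w) := by rw [exp_int_mul, exp_log hw]
  rw [conjPow, e2, ← Complex.exp_add, ← Complex.exp_add, ← h]
  congr 1
  linear_combination b * e

theorem conjPow_neg {w a b : ℂ} {k : ℤ} (hk : Even k) (h : a - b = k) :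
    conjPow (-w) a b = conjPow w a b := by
  rcases eq_or_ne w 0 with rfl | hw
  · simp
  rw [conjPow_eq (neg_ne_zero.2 hw) h, conjPow_eq hw h, norm_neg, hk.neg_zpow]

/-- The origin must be excluded: `log 0 = 0` gives `conjPow` the value `1` there, which is not
homogeneous. -/
theorem conjPow_ofReal_mul {r : ℝ} (hr : 0 < r) {w : ℂ} (hw : w ≠ 0) (a b : ℂ) :
    conjPow (r * w) a b = (r : ℂ) ^ (a + b) * conjPow w a b := by
  rw [conjPow, conjPow, log_ofReal_mul hr hw, cpow_def_of_ne_zero (ofReal_ne_zero.2 hr.ne'),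
    ← ofReal_log hr.le, map_add, conj_ofReal, ← Complex.exp_add, ← Complex.exp_add,
    ← Complex.exp_add]
  congr 1
  ring

theorem norm_conjPow {w a b : ℂ} (hw : w ≠ 0) {k : ℤ} (h : a - b = k) :
    ‖conjPow w a b‖ = ‖w‖ ^ (a + b).re := by
  have e : (a + b).re = 2 * b.re + k := by
    have := congrArg re h
    simp at this ⊢
    linarith
  rw [conjPow_eq hw h, norm_mul, norm_exp, norm_zpow, e, Real.rpow_add (norm_pos_iff.2 hw),
    Real.rpow_intCast, Real.rpow_def_of_pos (norm_pos_iff.2 hw)]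
  congr 2
  simp
  ring

/-- Write `x + i v = i (v - i x)`. The argument of `v - i x` is at most `π / 2` in size, so the
logarithms add without wrapping, and the quarter turn contributes `e ^ (-π i k / 2)`. -/
theorem conjPow_eq_linePowMul {α β : ℂ} {k : ℤ} (hk : Even k) (h : α - β = k) {v : ℝ}
    (hv : 0 < v) (x : ℝ) :
    conjPow (x + v * I) (-α) (-β) = (-1) ^ (k / 2) * linePowMul α β v x := by
  obtain ⟨j, rfl⟩ := hk
  have hz := sub_I_mul_ne_zero hv x
  have hz' := sub_I_mul_ne_zero hv (-x)
  have harg : |arg (v - I * x)| ≤ π / 2 := abs_arg_le_pi_div_two_iff.2 (by simpa using hv.le)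
  have hpi := Real.pi_pos
  have e1 : (x : ℂ) + v * I = I * (v - I * x) := by linear_combination (x : ℂ) * I_mul_I
  have e2 : log (x + v * I) = log (v - I * x) + π / 2 * I := by
    rw [e1, log_mul I_ne_zero hz, log_I, add_comm]
    rw [arg_I]
    rw [abs_le] at harg
    constructor <;> linarith
  have e3 : (starRingEnd ℂ) (log (v - I * x)) = log (v - I * (-x : ℝ)) := by
    rw [← log_conj]
    · congr 1
      simp
    · intro h
      rw [h, abs_of_pos hpi] at harg
      linarith
  have e4 : ((-1 : ℂ)) ^ ((j + j) / 2) = cexp (j * (-(π * I))) := by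
    rw [exp_int_mul, Complex.exp_neg, exp_pi_mul_I, show (j + j) / 2 = j by omega]
    norm_num
  rw [conjPow, e2, map_add, e3, e4, linePowMul, linePow, linePow, cpow_def_of_ne_zero hz,
    cpow_def_of_ne_zero hz', ← Complex.exp_add, ← Complex.exp_add, ← Complex.exp_add]
  congr 1
  have e5 : (starRingEnd ℂ) ((π : ℂ) / 2 * I) = -(π / 2 * I) := by
    rw [map_mul, map_div₀, conj_I, conj_ofReal, map_ofNat, mul_neg]
  rw [e5]
  push_cast at h
  linear_combination (-(π : ℂ) / 2 * I) * h

theorem intCast_mul_add_ne_zero (τ : ℍ) {p : ℤ × ℤ} (hp : p ≠ 0) :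
    (p.1 : ℂ) * τ + p.2 ≠ 0 := by
  intro h0
  refine hp ?_
  have him := congrArg im h0
  simp [τ.im_ne_zero] at him
  rw [him] at h0
  simp at h0
  exact Prod.ext him h0

theorem summable_conjPow {α β : ℂ} (hq : 2 < (α + β).re) {k : ℤ} (h : α - β = k) (τ : ℍ) :
    Summable fun p : ℤ × ℤ => ‖conjPow (p.1 * (τ : ℂ) + p.2) (-α) (-β)‖ := by
  have h' : -α - -β = ((-k : ℤ) : ℂ) := by push_cast; rw [← h]; ring
  have hs := ((EisensteinSeries.summable_one_div_norm_rpow hq).mul_left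
    (EisensteinSeries.r τ ^ (-(α + β).re))).comp_injective (finTwoArrowEquiv ℤ).symm.injective
  refine Summable.of_norm_bounded_eventually hs ?_
  filter_upwards [(Set.finite_singleton (0 : ℤ × ℤ)).compl_mem_cofinite] with p hp
  have hne := intCast_mul_add_ne_zero τ hp
  rw [norm_norm, norm_conjPow hne h']
  have := EisensteinSeries.summand_bound τ (k := (α + β).re) (by linarith)
    ((finTwoArrowEquiv ℤ).symm p)
  have e : (-α + -β).re = -(α + β).re := by simp; ring
  rw [e]
  exact this

/-! ### Sums over lattice points -/

/-- Sum of a homogeneous function over the positive multiples of the points of a set of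
primitive pairs. -/
theorem tsum_eq_zeta_mul_tsum {C Λ : Set (ℤ × ℤ)} (hC : ∀ p ∈ C, Int.gcd p.1 p.2 = 1)
    (hΛ : ∀ p, p ∈ Λ ↔ ∃ t : ℕ, 0 < t ∧ ∃ c ∈ C, p = ((t : ℤ) * c.1, (t : ℤ) * c.2))
    {F : ℤ × ℤ → ℂ} {q : ℂ} (hq : 1 < q.re)
    (hF : ∀ t : ℕ, 0 < t → ∀ c ∈ C, F ((t : ℤ) * c.1, (t : ℤ) * c.2) = (t : ℂ) ^ (-q) * F c)
    (hs : Summable fun c : C => ‖F c‖) :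
    ∑' p : Λ, F p = riemannZeta q * ∑' c : C, F c := by
  let f : ℕ × C → Λ := fun x =>
    ⟨(((x.1 + 1 : ℕ) : ℤ) * x.2.1.1, ((x.1 + 1 : ℕ) : ℤ) * x.2.1.2),
      (hΛ _).2 ⟨x.1 + 1, Nat.succ_pos _, x.2, x.2.2, rfl⟩⟩
  have hf : Function.Bijective f := by
    constructor
    · rintro ⟨t, c, hc⟩ ⟨t', c', hc'⟩ h
      have h := congrArg Subtype.val h
      simp only [f, Prod.mk.injEq] at h
      -- The multiplier is recovered as the gcd of the pair.
      have hg : t + 1 = t' + 1 := by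
        have e := congrArg₂ Int.gcd h.1 h.2
        rwa [Int.gcd_mul_left, Int.gcd_mul_left, hC c hc, hC c' hc', mul_one, mul_one,
          Int.natAbs_natCast, Int.natAbs_natCast] at e
      obtain rfl : t = t' := by omega
      have h0 : ((t + 1 : ℕ) : ℤ) ≠ 0 := by positivity
      have : c = c' := Prod.ext (mul_left_cancel₀ h0 h.1) (mul_left_cancel₀ h0 h.2)
      subst this
      rfl
    · rintro ⟨p, hp⟩
      obtain ⟨t, ht, c, hc, rfl⟩ := (hΛ p).1 hp
      refine ⟨(t - 1, ⟨c, hc⟩), Subtype.ext ?_⟩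
      simp only [f, Nat.sub_add_cancel ht]
  rw [← (Equiv.ofBijective f hf).tsum_eq, zeta_eq_tsum_one_div_nat_add_one_cpow hq,
    tsum_mul_tsum_of_summable_norm _ hs]
  · refine tsum_congr fun x => ?_
    rw [Equiv.ofBijective_apply, hF (x.1 + 1) (Nat.succ_pos _) x.2 x.2.2, cpow_neg, one_div]
    push_cast
    rfl
  · have h1 := ((summable_nat_add_iff 1).2 (summable_one_div_nat_cpow.2 hq)).norm
    exact_mod_cast h1

/-- Sum of an even function over a symmetric set of pairs, by rows. -/
theorem tsum_eq_row_zero_add {C : Set (ℤ × ℤ)} (hC : ∀ p, -p ∈ C ↔ p ∈ C) {F : ℤ × ℤ → ℂ}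
    (hF : ∀ p, F (-p) = F p) (hs : Summable F) :
    ∑' c : C, F c = ∑' n : ℤ, C.indicator F (0, n) +
      2 * ∑' m : ℕ, ∑' n : ℤ, C.indicator F ((m : ℤ) + 1, n) := by
  have hi : Summable (C.indicator F) := hs.indicator C
  have hrow : Summable fun m : ℤ => ∑' n : ℤ, C.indicator F (m, n) := hi.prod
  have heven : ∀ m : ℤ, ∑' n : ℤ, C.indicator F (-m, n) = ∑' n : ℤ, C.indicator F (m, n) := by
    intro m
    rw [← (Equiv.neg ℤ).tsum_eq]
    refine tsum_congr fun n => ?_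
    have e : ((-m, -n) : ℤ × ℤ) = -(m, n) := rfl
    rw [Equiv.neg_apply, e]
    by_cases h : (m, n) ∈ C
    · rw [Set.indicator_of_mem h, Set.indicator_of_mem ((hC _).2 h), hF]
    · rw [Set.indicator_of_notMem h, Set.indicator_of_notMem (fun h' => h ((hC _).1 h'))]
  have hpos : Summable fun m : ℕ => ∑' n : ℤ, C.indicator F ((m : ℤ) + 1, n) :=
    hrow.comp_injective (i := fun m : ℕ => (m : ℤ) + 1) fun a b h => by simpa using h
  have hneg : Summable fun m : ℕ => ∑' n : ℤ, C.indicator F (-((m : ℤ) + 1), n) :=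
    hpos.congr fun m => (heven ((m : ℤ) + 1)).symm
  have e := tsum_of_add_one_of_neg_add_one
    (f := fun m : ℤ => ∑' n : ℤ, C.indicator F (m, n)) hpos hneg
  rw [tsum_congr fun m : ℕ => heven ((m : ℤ) + 1)] at e
  rw [tsum_subtype, hi.tsum_prod, e]
  ring

/-! ### Poisson summation along a row -/

/-- The contribution of frequency `n` to the periodization of the summand. -/
noncomputable def rowCoeff (α β : ℂ) (τ : ℍ) (n : ℤ) : ℂ :=
  𝓕 (linePowMul α β τ.im) (n : ℝ) * cexp (2 * π * I * n * τ.re)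

theorem summable_norm_rowCoeff {α β : ℂ} (h : 1 < (α + β).re) (τ : ℍ) :
    Summable fun n : ℤ => ‖rowCoeff α β τ n‖ := by
  have : ∀ n : ℤ, ‖rowCoeff α β τ n‖ = ‖𝓕 (linePowMul α β τ.im) (n : ℝ)‖ := by
    intro n
    have e : 2 * π * I * n * τ.re = ((2 * π * n * τ.re : ℝ) : ℂ) * I := by push_cast; ring
    rw [rowCoeff, norm_mul, e, norm_exp_ofReal_mul_I, mul_one]
  simpa only [this] using summable_fourier_linePowMul τ.im_pos h

/-- With `n = l M + a` the linear form is `M (τ + a / M + l)`. Poisson summation over `l` gives the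
phase `e ^ (2 π i ν a / M)`, and the phases of the `a` prime to `M` add up to the Ramanujan sum. -/
theorem tsum_coprime_conjPow {α β : ℂ} (hq : 2 < (α + β).re) {k : ℤ} (hk : Even k)
    (h : α - β = k) (τ : ℍ) {M : ℕ} (hM : 0 < M) :
    ∑' n : ℤ, (if Int.gcd M n = 1 then conjPow (M * (τ : ℂ) + n) (-α) (-β) else 0) =
      (-1) ^ (k / 2) * ∑' ν : ℤ, ramanujanG ν M / (M : ℂ) ^ (α + β) * rowCoeff α β τ ν := by
  have : NeZero M := ⟨hM.ne'⟩
  have hM0 : (M : ℂ) ≠ 0 := by exact_mod_cast hM.ne'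
  have hMr : (0 : ℝ) < M := by exact_mod_cast hM
  have hc := summable_norm_rowCoeff (α := α) (β := β) (by linarith) τ
  have hrow : Summable fun n : ℤ =>
      if Int.gcd M n = 1 then conjPow (M * (τ : ℂ) + n) (-α) (-β) else 0 := by
    have := (summable_conjPow hq h τ).comp_injective (i := fun n : ℤ => ((M : ℤ), n))
      fun a b hab => by simpa using hab
    refine Summable.of_norm_bounded this fun n => ?_
    split_ifs <;> simp
  set e : Fin M × ℤ ≃ ℤ := (Equiv.prodComm _ _).trans (Int.divModEquiv M).symm with he
  have hea : ∀ a l, e (a, l) = l * M + (a : ℕ) := fun _ _ => rfl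
  have hrow' : Summable fun p : Fin M × ℤ => if Int.gcd M (e p) = 1 then
      conjPow (M * (τ : ℂ) + (e p : ℤ)) (-α) (-β) else 0 := hrow.comp_injective e.injective
  rw [← e.tsum_eq, Summable.tsum_prod hrow', tsum_fintype]
  have hsum : ∀ a : Fin M, (∑' l : ℤ, if Int.gcd M (e (a, l)) = 1 then
      conjPow (M * (τ : ℂ) + (e (a, l) : ℤ)) (-α) (-β) else 0) =
      (-1) ^ (k / 2) * ∑' ν : ℤ, (if Nat.Coprime (a : ℕ) M then
        cexp (2 * π * I * (a : ℕ) / M) ^ ν else 0) / (M : ℂ) ^ (α + β) * rowCoeff α β τ ν := by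
    intro a
    have hg : ∀ l, Int.gcd M (e (a, l)) = 1 ↔ Nat.Coprime (a : ℕ) M := by
      intro l
      rw [hea, mul_comm, add_comm, Int.gcd_add_mul_left_right, Int.gcd_natCast_natCast,
          Nat.coprime_comm]
    by_cases hca : Nat.Coprime (a : ℕ) M
    · have e1 : ∀ l : ℤ, conjPow (M * (τ : ℂ) + (e (a, l) : ℤ)) (-α) (-β) =
          (M : ℂ) ^ (-(α + β)) * (-1) ^ (k / 2) *
            linePowMul α β τ.im (τ.re + (a : ℕ) / M + l) := by
        intro l
        have hw : ((τ.re + (a : ℕ) / M + l : ℝ) : ℂ) + τ.im * I ≠ 0 := by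
          intro h0
          have := congrArg im h0
          simp [τ.im_ne_zero] at this
        rw [mul_assoc, ← conjPow_eq_linePowMul hk h τ.im_pos,
          show -(α + β) = -α + -β by ring, ← ofReal_natCast, ← conjPow_ofReal_mul hMr hw, hea]
        congr 1
        push_cast
        have hτ : (τ : ℂ) = τ.re + τ.im * I := (re_add_im (τ : ℂ)).symm
        rw [hτ]
        field_simp
        ring
      rw [tsum_congr fun l => (if_pos ((hg l).2 hca)).trans (e1 l),
        tsum_mul_left, tsum_linePowMul_add_int τ.im_pos (by linarith), mul_comm (_ ^ _),
        mul_assoc, ← tsum_mul_left]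
      congr 1
      refine tsum_congr fun ν => ?_
      rw [if_pos hca, cpow_neg, rowCoeff, ← exp_int_mul]
      have e2 : cexp (2 * π * I * ν * (τ.re + (a : ℕ) / M : ℝ)) =
          cexp (ν * (2 * π * I * (a : ℕ) / M)) * cexp (2 * π * I * ν * τ.re) := by
        rw [← Complex.exp_add]
        congr 1
        push_cast
        ring
      rw [e2]
      ring
    · simp [hg, hca]
  rw [Finset.sum_congr rfl fun a _ => hsum a, ← Finset.mul_sum, ← Summable.tsum_finsetSum]
  · congr 1
    refine tsum_congr fun ν => ?_
    rw [← Finset.sum_mul, ← Finset.sum_div, ramanujanG, Finset.sum_filter, Finset.sum_range]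
  · intro a _
    refine Summable.of_norm_bounded (hc.mul_left (1 / ‖(M : ℂ) ^ (α + β)‖)) fun ν => ?_
    rw [norm_mul, norm_div]
    gcongr
    split_ifs
    · have e : 2 * π * I * (a : ℕ) / M = ((2 * π * (a : ℕ) / M : ℝ) : ℂ) * I := by
        push_cast; ring
      rw [norm_zpow, e, norm_exp_ofReal_mul_I, one_zpow]
    · simp

/-- Fubini for sums; the bound `B` independent of `ν` makes the double series dominated by a
product. -/
theorem summable_and_tsum_comm_of_norm_le {A : ℤ → ℕ → ℂ} {B : ℕ → ℝ} {c : ℤ → ℂ}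
    (hA : ∀ ν m, ‖A ν m‖ ≤ B m) (hB : Summable B) (hc : Summable fun ν => ‖c ν‖) :
    (Summable fun ν => c ν * ∑' m, A ν m) ∧
      ∑' m, ∑' ν, A ν m * c ν = ∑' ν, c ν * ∑' m, A ν m := by
  have hs : Summable (Function.uncurry fun ν m => A ν m * c ν) := by
    have hB0 : ∀ m, 0 ≤ B m := fun m => (norm_nonneg _).trans (hA 0 m)
    refine Summable.of_norm_bounded (hc.mul_of_nonneg hB (fun _ => norm_nonneg _) hB0) fun p => ?_
    rw [Function.uncurry, norm_mul, mul_comm]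
    gcongr
    exact hA _ _
  have e : ∀ ν, ∑' m, A ν m * c ν = c ν * ∑' m, A ν m := fun ν => by
    rw [tsum_mul_right, mul_comm]
  exact ⟨hs.prod.congr e, hs.tsum_comm.trans (tsum_congr e)⟩

theorem norm_term_ramanujanG_mul_le (N : ℕ) (b : ℤ) (s : ℂ) (m : ℕ) :
    ‖LSeries.term (fun n => ramanujanG b (N * n)) s m‖ ≤ N * (m : ℝ) ^ (1 - s.re) := by
  rcases eq_or_ne m 0 with rfl | hm
  · simp only [LSeries.term_zero, norm_zero]
    positivity
  have hm0 : (0 : ℝ) < m := by exact_mod_cast Nat.pos_of_ne_zero hm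
  rw [LSeries.norm_term_eq, if_neg hm, Real.rpow_sub hm0, Real.rpow_one, ← mul_div_assoc]
  gcongr
  exact_mod_cast norm_ramanujanG_le b (N * m)

theorem summable_mul_rpow (N : ℕ) {s : ℝ} (hs : 2 < s) :
    Summable fun m : ℕ => N * (m : ℝ) ^ (1 - s) :=
  (Real.summable_nat_rpow.2 (by linarith)).mul_left _

theorem tsum_nat_add_one_of_zero {f : ℕ → ℂ} (hf : Summable f) (h0 : f 0 = 0) :
    ∑' m : ℕ, f (m + 1) = ∑' m, f m := by
  rw [hf.tsum_eq_zero_add, h0, zero_add]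

/-! ### The two Eisenstein series -/

/-- That `gcd (N m, n) = t` does not force `t ∣ m`; the divisibility conditions make the quotient by
`t` an integral pair. -/
theorem mem_latticeL {N : ℕ} {p : ℤ × ℤ} :
    p ∈ latticeL N ↔ ∃ t : ℕ, 0 < t ∧ ∃ c ∈ {c : ℤ × ℤ | Int.gcd (N * c.1) c.2 = 1},
      p = ((t : ℤ) * c.1, (t : ℤ) * c.2) := by
  simp only [latticeL, Set.mem_iUnion, Set.mem_ofPred_eq, Subtype.exists, exists_prop]
  refine exists_congr fun t => and_congr_right fun ht => ⟨?_, ?_⟩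
  · rintro ⟨⟨a, ha⟩, ⟨b, hb⟩, h⟩
    refine ⟨(a, b), ?_, Prod.ext ha hb⟩
    rw [ha, hb, mul_left_comm, Int.gcd_mul_left, Int.natAbs_natCast] at h
    exact Nat.eq_of_mul_eq_mul_left ht (h.trans (mul_one t).symm)
  · rintro ⟨c, hc, rfl⟩
    refine ⟨dvd_mul_right _ _, dvd_mul_right _ _, ?_⟩
    rw [mul_left_comm, Int.gcd_mul_left, hc, Int.natAbs_natCast, mul_one]

theorem mem_latticeR {N : ℕ} {p : ℤ × ℤ} :
    p ∈ latticeR N ↔ ∃ t : ℕ, 0 < t ∧ ∃ c ∈ {c : ℤ × ℤ | Int.gcd c.1 (N * c.2) = 1},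
      p = ((t : ℤ) * c.1, (t : ℤ) * c.2) := by
  simp only [latticeR, Set.mem_iUnion, Set.mem_ofPred_eq, Subtype.exists, exists_prop]
  refine exists_congr fun t => and_congr_right fun ht => ⟨?_, ?_⟩
  · rintro ⟨⟨a, ha⟩, ⟨b, hb⟩, h⟩
    refine ⟨(a, b), ?_, Prod.ext ha hb⟩
    rw [ha, hb, mul_left_comm, Int.gcd_mul_left, Int.natAbs_natCast] at h
    exact Nat.eq_of_mul_eq_mul_left ht (h.trans (mul_one t).symm)
  · rintro ⟨c, hc, rfl⟩
    refine ⟨dvd_mul_right _ _, dvd_mul_right _ _, ?_⟩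
    rw [mul_left_comm, Int.gcd_mul_left, hc, Int.natAbs_natCast, mul_one]

theorem conjPow_natCast_mul (α β : ℂ) {t : ℕ} (ht : 0 < t) {w : ℂ}
    (hw : w ≠ 0) : conjPow (t * w) (-α) (-β) = (t : ℂ) ^ (-(α + β)) * conjPow w (-α) (-β) := by
  rw [neg_add, ← ofReal_natCast]
  exact conjPow_ofReal_mul (by exact_mod_cast ht) hw _ _

/-- The point `z / √N` of the upper half plane. -/
noncomputable def rescale (N : ℕ) (hN : 0 < N) (z : ℍ) : ℍ :=
  ⟨(z : ℂ) / (√(N : ℝ) : ℝ), by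
    rw [div_ofReal_im]
    have : 0 < √(N : ℝ) := Real.sqrt_pos.2 (by exact_mod_cast hN)
    exact div_pos z.im_pos this⟩

section

variable {N : ℕ} (hN : 0 < N) {α β : ℂ} (hq : 2 < (α + β).re) {k : ℤ} (hk : Even k)
  (h : α - β = k) (z : ℍ)
include hN

theorem sqrt_natCast_pos : 0 < √(N : ℝ) := Real.sqrt_pos.2 (by exact_mod_cast hN)

theorem eisTermL_eq (p : ℤ × ℤ) :
    eisTermL N z α β p =
      conjPow (((N * p.1 : ℤ) : ℂ) * (rescale N hN z : ℂ) + p.2) (-α) (-β) := by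
  have h1 : ((√(N : ℝ) : ℝ) : ℂ) ≠ 0 := ofReal_ne_zero.2 (sqrt_natCast_pos hN).ne'
  have h2 : ((√(N : ℝ) : ℝ) : ℂ) * (√(N : ℝ) : ℝ) = N := by
    rw [← ofReal_mul, Real.mul_self_sqrt (Nat.cast_nonneg N), ofReal_natCast]
  rw [eisTermL]
  congr 2
  change _ = ((N * p.1 : ℤ) : ℂ) * ((z : ℂ) / (√(N : ℝ) : ℝ))
  field_simp
  push_cast
  linear_combination (p.1 * z : ℂ) * h2

theorem eisTermR_eq {p : ℤ × ℤ} (hp : p ≠ 0) :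
    eisTermR N z α β p = (N : ℂ) ^ (-(α + β) / 2) *
      conjPow ((p.1 : ℂ) * (rescale N hN z : ℂ) + p.2) (-α) (-β) := by
  have h0 := sqrt_natCast_pos hN
  have h1 : ((√(N : ℝ) : ℝ) : ℂ) ≠ 0 := ofReal_ne_zero.2 h0.ne'
  have hN0 : (N : ℂ) ≠ 0 := by exact_mod_cast hN.ne'
  have h2 : ((√(N : ℝ) : ℝ) : ℂ) ^ (-α + -β) = (N : ℂ) ^ (-(α + β) / 2) := by
    rw [cpow_def_of_ne_zero h1, cpow_def_of_ne_zero hN0, ← ofReal_log h0.le,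
      Real.log_sqrt (Nat.cast_nonneg N), ← ofReal_natCast, ← ofReal_log (Nat.cast_nonneg N)]
    congr 1
    push_cast
    ring
  rw [eisTermR, ← h2, ← conjPow_ofReal_mul h0 (intCast_mul_add_ne_zero _ hp)]
  congr 1
  change _ = _ * ((p.1 : ℂ) * ((z : ℂ) / (√(N : ℝ) : ℝ)) + p.2)
  field_simp

theorem eisTermL_smul {t : ℕ} (ht : 0 < t) {p : ℤ × ℤ} (hp : p ≠ 0) :
    eisTermL N z α β ((t : ℤ) * p.1, (t : ℤ) * p.2) =
      (t : ℂ) ^ (-(α + β)) * eisTermL N z α β p := by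
  have hp' : ((N : ℤ) * p.1, p.2) ≠ 0 := by
    contrapose! hp
    simp only [Prod.mk_eq_zero, mul_eq_zero, Nat.cast_eq_zero, hN.ne', false_or] at hp
    exact Prod.ext hp.1 hp.2
  rw [eisTermL_eq hN, eisTermL_eq hN, ← conjPow_natCast_mul α β ht
    (intCast_mul_add_ne_zero (rescale N hN z) hp')]
  congr 1
  push_cast
  ring

theorem eisTermR_smul {t : ℕ} (ht : 0 < t) {p : ℤ × ℤ} (hp : p ≠ 0) :
    eisTermR N z α β ((t : ℤ) * p.1, (t : ℤ) * p.2) =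
      (t : ℂ) ^ (-(α + β)) * eisTermR N z α β p := by
  have ht0 : (t : ℤ) ≠ 0 := by exact_mod_cast ht.ne'
  have hp' : ((t : ℤ) * p.1, (t : ℤ) * p.2) ≠ 0 := by
    contrapose! hp
    simp only [Prod.mk_eq_zero, mul_eq_zero, ht0, false_or] at hp
    exact Prod.ext hp.1 hp.2
  rw [eisTermR_eq hN z hp', eisTermR_eq hN z hp, mul_left_comm, ← conjPow_natCast_mul α β ht
    (intCast_mul_add_ne_zero (rescale N hN z) hp)]
  congr 2
  push_cast
  ring

include hq h

theorem summable_eisTermL : Summable fun p => ‖eisTermL N z α β p‖ := by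
  simp only [eisTermL_eq hN]
  refine (summable_conjPow hq h (rescale N hN z)).comp_injective
    (i := fun p : ℤ × ℤ => (N * p.1, p.2)) fun a b hab => ?_
  simp only [Prod.mk.injEq] at hab
  exact Prod.ext (mul_left_cancel₀ (by positivity) hab.1) hab.2

theorem summable_eisTermR : Summable fun p => ‖eisTermR N z α β p‖ := by
  refine Summable.of_norm_bounded_eventually ((summable_conjPow hq h (rescale N hN z)).mul_left
    ‖(N : ℂ) ^ (-(α + β) / 2)‖) ?_
  filter_upwards [(Set.finite_singleton (0 : ℤ × ℤ)).compl_mem_cofinite] with p hp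
  rw [norm_norm, eisTermR_eq hN z hp, norm_mul]

include hk

/-- Row zero of the primitive pairs is `(0, ±1)`, each of value `1`, which gives the summand `2`;
the other rows are those with `M = N (m + 1)`. -/
theorem eisL_eq :
    eisL N z α β = riemannZeta (α + β) * (2 + 2 * ((-1) ^ (k / 2) * ∑' m : ℕ, ∑' ν : ℤ,
      ramanujanG ν (N * (m + 1)) / ((N * (m + 1) : ℕ) : ℂ) ^ (α + β) *
        rowCoeff α β (rescale N hN z) ν)) := by
  have h' : -α - -β = ((-k : ℤ) : ℂ) := by push_cast; rw [← h]; ring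
  have hs := summable_eisTermL hN hq h z
  have hC : ∀ p ∈ {c : ℤ × ℤ | Int.gcd (N * c.1) c.2 = 1}, Int.gcd p.1 p.2 = 1 := fun p hp =>
    Int.isCoprime_iff_gcd_eq_one.1
      (IsCoprime.of_mul_left_right (Int.isCoprime_iff_gcd_eq_one.2 hp))
  rw [eisL, tsum_eq_zeta_mul_tsum hC (fun _ => mem_latticeL) (F := eisTermL N z α β)
    (by linarith) (fun t ht c hc => eisTermL_smul hN z ht (by rintro rfl; simpa using hC _ hc))
    (hs.subtype _), tsum_eq_row_zero_add (fun p => by simp) (fun p => ?_) hs.of_norm]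
  · congr 2
    · rw [tsum_eq_sum (s := {1, -1}), Finset.sum_pair (by norm_num)]
      · rw [Set.indicator_of_mem (by simp), Set.indicator_of_mem (by simp), eisTermL, eisTermL]
        simp only [Int.cast_zero, mul_zero, zero_mul, zero_add, Int.cast_one, Int.cast_neg]
        rw [conjPow_neg hk.neg h']
        simp [conjPow]
        norm_num
      · intro n hn
        refine Set.indicator_of_notMem (fun hmem => hn ?_) _
        simp only [Set.mem_ofPred_eq, mul_zero, Int.gcd_zero_left] at hmem
        rcases Int.natAbs_eq_iff.1 hmem with rfl | rfl <;> simp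
    · congr 1
      rw [← tsum_mul_left]
      refine tsum_congr fun m => ?_
      rw [← tsum_coprime_conjPow hq hk h (rescale N hN z) (M := N * (m + 1)) (by positivity)]
      refine tsum_congr fun n => ?_
      rw [Set.indicator_apply, eisTermL_eq hN]
      simp
  · rw [eisTermL_eq hN, eisTermL_eq hN, ← conjPow_neg hk.neg h']
    congr 1
    simp
    ring

/-- A pair is primitive here when `m` is prime to both `N` and `n`, so only rows prime to `N`
survive. Row zero would require `N n = ±1`, impossible for `N > 1`. -/
theorem eisR_eq (hN1 : 1 < N) :
    eisR N z α β = riemannZeta (α + β) * (N : ℂ) ^ (-(α + β) / 2) *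
      (2 * ((-1) ^ (k / 2) * ∑' m : ℕ, ∑' ν : ℤ, (if (m + 1).Coprime N then
        ramanujanG ν (m + 1) / ((m + 1 : ℕ) : ℂ) ^ (α + β) else 0) *
          rowCoeff α β (rescale N hN z) ν)) := by
  have h' : -α - -β = ((-k : ℤ) : ℂ) := by push_cast; rw [← h]; ring
  have hs := summable_eisTermR hN hq h z
  have hC : ∀ p ∈ {c : ℤ × ℤ | Int.gcd c.1 (N * c.2) = 1}, Int.gcd p.1 p.2 = 1 := fun p hp =>
    Int.isCoprime_iff_gcd_eq_one.1
      (IsCoprime.of_mul_right_right (Int.isCoprime_iff_gcd_eq_one.2 hp))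
  rw [eisR, tsum_eq_zeta_mul_tsum hC (fun _ => mem_latticeR) (F := eisTermR N z α β)
    (by linarith) (fun t ht c hc => eisTermR_smul hN z ht (by rintro rfl; simpa using hC _ hc))
    (hs.subtype _), tsum_eq_row_zero_add (fun p => by simp) (fun p => ?_) hs.of_norm, mul_assoc]
  · congr 1
    rw [tsum_congr (g := fun _ => (0 : ℂ)), tsum_zero, zero_add, mul_left_comm]
    · congr 1
      rw [← tsum_mul_left, ← tsum_mul_left]
      refine tsum_congr fun m => ?_
      have hne : ∀ n : ℤ, ((m : ℤ) + 1, n) ≠ 0 := fun n hn => by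
        have := congrArg Prod.fst hn
        simp at this
        omega
      by_cases hm : (m + 1).Coprime N
      · simp only [if_pos hm]
        rw [← tsum_coprime_conjPow hq hk h (rescale N hN z) (M := m + 1) (by positivity),
          ← tsum_mul_left]
        refine tsum_congr fun n => ?_
        have hiff : ((m : ℤ) + 1, n) ∈ {c : ℤ × ℤ | Int.gcd c.1 (N * c.2) = 1} ↔
            Int.gcd (m + 1 : ℕ) n = 1 := by
          simp only [Set.mem_ofPred_eq]
          rw [← Int.isCoprime_iff_gcd_eq_one, ← Int.isCoprime_iff_gcd_eq_one,
            IsCoprime.mul_right_iff, and_iff_right]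
          · push_cast
            rfl
          · exact_mod_cast Nat.isCoprime_iff_coprime.2 hm
        rw [Set.indicator_apply, eisTermR_eq hN z (hne n)]
        by_cases hc : Int.gcd (m + 1 : ℕ) n = 1
        · rw [if_pos (hiff.2 hc), if_pos hc]
          push_cast
          rfl
        · rw [if_neg (fun h => hc (hiff.1 h)), if_neg hc, mul_zero]
      · simp only [if_neg hm, zero_mul, tsum_zero, mul_zero]
        rw [tsum_congr (g := fun _ => (0 : ℂ)), tsum_zero]
        intro n
        refine Set.indicator_of_notMem (fun hmem => hm ?_) _
        have : IsCoprime ((m : ℤ) + 1) N :=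
          IsCoprime.of_mul_right_left (Int.isCoprime_iff_gcd_eq_one.2 hmem)
        exact Nat.isCoprime_iff_coprime.1 (by exact_mod_cast this)
    · intro n
      refine Set.indicator_of_notMem (fun hmem => ?_) _
      simp only [Set.mem_ofPred_eq, Int.gcd_zero_left, Int.natAbs_mul, Int.natAbs_natCast] at hmem
      have := Nat.eq_one_of_mul_eq_one_right hmem
      omega
  · rcases eq_or_ne p 0 with rfl | hp
    · simp
    rw [eisTermR_eq hN z hp, eisTermR_eq hN z (neg_ne_zero.2 hp), ← conjPow_neg hk.neg h']
    congr 2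
    simp
    ring

/-- The L part carries `N ^ (-q)` from `(N m) ^ (-q)`, the R part `N ^ (-q/2)` from rescaling; the
common factor `N ^ (-q/2)` leaves exactly `eisArith`. -/
theorem eis_eq (hN1 : 1 < N) :
    (Summable fun ν : ℤ => rowCoeff α β (rescale N hN z) ν * eisArith N ν (α + β)) ∧
    eis N z α β = 2 * riemannZeta (α + β) + 2 * (-1) ^ (k / 2) * riemannZeta (α + β) *
      ((N : ℂ) ^ (-(α + β) / 2) *
        ∑' ν : ℤ, rowCoeff α β (rescale N hN z) ν * eisArith N ν (α + β)) := by
  set τ := rescale N hN z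
  set q := α + β with hqdef
  have hc := summable_norm_rowCoeff (α := α) (β := β) (by linarith) τ
  obtain ⟨s1, e1⟩ := summable_and_tsum_comm_of_norm_le
    (A := fun ν m => LSeries.term (fun n => ramanujanG ν (N * n)) q (m + 1))
    (fun ν m => norm_term_ramanujanG_mul_le N ν q (m + 1))
    ((summable_nat_add_iff 1).2 (summable_mul_rpow N hq)) hc
  obtain ⟨s2, e2⟩ := summable_and_tsum_comm_of_norm_le
    (A := fun ν m => if (m + 1).Coprime N then LSeries.term (ramanujanG ν) q (m + 1) else 0)
    (B := fun m => ((1 : ℕ) : ℝ) * ((m + 1 : ℕ) : ℝ) ^ (1 - q.re))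
    (fun ν m => by
      have := norm_term_ramanujanG_mul_le 1 ν q (m + 1)
      simp only [one_mul] at this
      split_ifs
      · simpa using this
      · rw [norm_zero]
        positivity)
    ((summable_nat_add_iff 1).2 (summable_mul_rpow 1 hq)) hc
  have f1 : ∀ ν, ∑' m : ℕ, LSeries.term (fun n => ramanujanG ν (N * n)) q (m + 1) =
      ramanujanLShift N ν q := fun ν =>
    tsum_nat_add_one_of_zero (lseriesSummable_ramanujanG_mul N ν hq) (LSeries.term_zero _ _)
  have f2 : ∀ ν, (∑' m : ℕ, if (m + 1).Coprime N then LSeries.term (ramanujanG ν) q (m + 1)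
      else 0) = ramanujanL ν q / ramanujanLLocal N ν q := fun ν => by
    rw [← tsum_coprime_ramanujanG hN.ne' ν hq]
    refine tsum_nat_add_one_of_zero
      (f := fun m => if m.Coprime N then LSeries.term (ramanujanG ν) q m else 0) ?_ (by simp)
    refine Summable.of_norm_bounded (lseriesSummable_ramanujanG ν hq).norm fun m => ?_
    split_ifs <;> simp
  simp only [f1, f2] at s1 e1 s2 e2
  have hN0 : (N : ℂ) ≠ 0 := by exact_mod_cast hN.ne'
  have hsum : ∀ ν, rowCoeff α β τ ν * eisArith N ν q =
      (N : ℂ) ^ (-q / 2) * (rowCoeff α β τ ν * ramanujanLShift N ν q) +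
        rowCoeff α β τ ν * (ramanujanL ν q / ramanujanLLocal N ν q) := fun ν => by
    rw [eisArith]
    ring
  have s3 := s1.mul_left ((N : ℂ) ^ (-q / 2))
  refine ⟨(s3.add s2).congr fun ν => (hsum ν).symm, ?_⟩
  rw [tsum_congr hsum, s3.tsum_add s2, tsum_mul_left, ← e1, ← e2, eis, eisL_eq hN hq hk h z,
    eisR_eq hN hq hk h z hN1]
  have g1 : (∑' m : ℕ, ∑' ν : ℤ, ramanujanG ν (N * (m + 1)) /
      ((N * (m + 1) : ℕ) : ℂ) ^ q * rowCoeff α β τ ν) = (N : ℂ) ^ (-q) * ∑' m : ℕ, ∑' ν : ℤ,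
        LSeries.term (fun n => ramanujanG ν (N * n)) q (m + 1) * rowCoeff α β τ ν := by
    rw [← tsum_mul_left]
    refine tsum_congr fun m => ?_
    rw [← tsum_mul_left]
    refine tsum_congr fun ν => ?_
    rw [LSeries.term_of_ne_zero m.succ_ne_zero, Nat.cast_mul, natCast_mul_natCast_cpow, cpow_neg]
    field_simp
  have g2 : (N : ℂ) ^ (-q) = (N : ℂ) ^ (-q / 2) * (N : ℂ) ^ (-q / 2) := by
    rw [← cpow_add _ _ hN0, add_halves]
  rw [← hqdef, g1, g2]
  simp only [LSeries.term_of_ne_zero (Nat.succ_ne_zero _)]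
  ring

end

/-! ### The Fourier coefficients in terms of Whittaker functions -/

/-- Accounts for the constant `√2 π` in the expansion: it balances the powers in the normalization
of `W` against those in the Fourier transform. -/
theorem whittaker_prefactor (q : ℂ) {ξ v : ℝ} (hξ : 0 < ξ) (hv : 0 < v) :
    ((√2 * π : ℝ) : ℂ) ^ q * (ξ : ℂ) ^ (q - 1) * (((2 * π * ξ * v : ℝ) : ℂ) ^ (-q / 2) *
      ((4 * π * v * ξ : ℝ) : ℂ) ^ (1 / 2 - (q - 1) / 2)) =
      2 * π * ((2 * v : ℝ) : ℂ) ^ (1 - q) := by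
  have hpi := Real.pi_pos
  have h2 : (2 : ℂ) = cexp (Real.log 2 : ℝ) := by
    rw [← ofReal_exp, Real.exp_log (by norm_num)]; norm_num
  have h3 : (π : ℂ) = cexp (Real.log π : ℝ) := by rw [← ofReal_exp, Real.exp_log hpi]
  have key : ∀ {x : ℝ} (_ : 0 < x) (c : ℂ), (x : ℂ) ^ c = cexp ((Real.log x : ℝ) * c) := by
    intro x hx c
    rw [cpow_def_of_ne_zero (ofReal_ne_zero.2 hx.ne'), ofReal_log hx.le]
  have l2 : Real.log 4 = 2 * Real.log 2 := by
    rw [show (4 : ℝ) = 2 ^ 2 by norm_num, Real.log_pow]; norm_num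
  have e1 : Real.log (√2 * π) = Real.log 2 / 2 + Real.log π := by
    rw [Real.log_mul (by positivity) (by positivity), Real.log_sqrt (by norm_num)]
  have e2 : Real.log (2 * π * ξ * v) = Real.log 2 + Real.log π + Real.log ξ + Real.log v := by
    rw [Real.log_mul (by positivity) (by positivity), Real.log_mul (by positivity) (by positivity),
      Real.log_mul (by positivity) (by positivity)]
  have e3 : Real.log (4 * π * v * ξ) = 2 * Real.log 2 + Real.log π + Real.log v + Real.log ξ := by
    rw [Real.log_mul (by positivity) (by positivity), Real.log_mul (by positivity) (by positivity),
      Real.log_mul (by positivity) (by positivity), l2]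
  have e4 : Real.log (2 * v) = Real.log 2 + Real.log v :=
    Real.log_mul (by positivity) (by positivity)
  rw [key (by positivity), key hξ, key (by positivity), key (by positivity), key (by positivity),
    e1, e2, e3, e4]
  conv_rhs => rw [h2, h3]
  simp only [← Complex.exp_add]
  congr 1
  push_cast
  ring

theorem whittakerW_eq_fourier_of_pos {a b κ μ : ℂ} (hab : 2 < (a + b).re) {ξ v : ℝ}
    (hξ : 0 < ξ) (hv : 0 < v) (hκ : κ = (a - b) / 2) (hμ : μ = (a + b - 1) / 2) :
    ((√2 * π : ℝ) : ℂ) ^ (a + b) * ((ξ : ℂ) ^ (a + b - 1) / Gamma a *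
      (((2 * π * ξ * v : ℝ) : ℂ) ^ (-(a + b) / 2) * whittakerW κ μ (2 * (2 * π * ξ * v)))) =
      𝓕 (linePowMul a b v) ξ := by
  have e1 : μ + 1 / 2 - κ = b := by rw [hκ, hμ]; ring
  have e2 : μ + κ + 1 / 2 = a := by rw [hκ, hμ]; ring
  have e3 : 2 * (2 * π * ξ * v) = 4 * π * v * ξ := by ring
  have e4 : cexp (-((4 * π * v * ξ : ℝ) : ℂ) / 2) = cexp (-(2 * π * v * ξ)) := by
    congr 1
    push_cast
    ring
  rw [fourier_linePowMul_of_pos hv hab hξ, ← whittaker_prefactor (a + b) hξ hv, whittakerW_eq,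
    e1, e2, e3, e4, hμ]
  ring

section

variable {N : ℕ} (hN : 0 < N) {α β : ℂ} (hq : 2 < (α + β).re) (z : ℍ)
include hN

theorem rescale_re : (rescale N hN z).re = z.re / √(N : ℝ) := div_ofReal_re _ _

theorem rescale_im : (rescale N hN z).im = z.im / √(N : ℝ) := div_ofReal_im _ _

include hq

/-- Reflection `x ↦ -x` exchanges `α` and `β` at negative frequencies; this is the origin of
`sgn(n)` in the gamma factor and in the Whittaker index. -/
theorem modWhittakerW_eq_fourier {n : ℤ} (hn : n ≠ 0) :
    ((√2 * π : ℝ) : ℂ) ^ (α + β) * (((|n| : ℤ) : ℂ) ^ (α + β - 1) /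
      Gamma ((α + β) / 2 + (n.sign : ℂ) * ((α - β) / 2)) *
      modWhittakerW (2 * π * n * z.im / √(N : ℝ)) α β) =
      𝓕 (linePowMul α β (rescale N hN z).im) (n : ℝ) := by
  have hv := (rescale N hN z).im_pos
  have ht : 2 * π * n * z.im / √(N : ℝ) = 2 * π * n * (rescale N hN z).im := by
    rw [rescale_im]
    ring
  rw [ht]
  set v := (rescale N hN z).im
  rcases hn.lt_or_gt with hneg | hpos
  · have hξ : (0 : ℝ) < -(n : ℝ) := by
      have : (n : ℝ) < 0 := by exact_mod_cast hneg
      linarith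
    have ht0 : 2 * π * (n : ℝ) * v < 0 := by
      have : 0 < 2 * π * (-(n : ℝ)) * v := by positivity
      linarith
    have hF := whittakerW_eq_fourier_of_pos (a := β) (b := α)
      (κ := ((-1 : ℝ) : ℂ) * (α - β) / 2) (μ := (α + β - 1) / 2) (by rwa [add_comm]) hξ hv
      (by push_cast; ring) (by ring)
    rw [fourier_linePowMul_neg, add_comm β α] at hF
    rw [← hF, modWhittakerW, Real.sign_of_neg ht0, abs_of_neg ht0, abs_of_neg hneg,
      Int.sign_eq_neg_one_of_neg hneg,
      show -(2 * π * (n : ℝ) * v) = 2 * π * (-(n : ℝ)) * v by ring,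
      show (α + β) / 2 + (((-1 : ℤ) : ℂ)) * ((α - β) / 2) = β by push_cast; ring]
    push_cast
    rfl
  · have hξ : (0 : ℝ) < (n : ℝ) := by exact_mod_cast hpos
    have ht0 : 0 < 2 * π * (n : ℝ) * v := by positivity
    have hF := whittakerW_eq_fourier_of_pos (a := α) (b := β)
      (κ := ((1 : ℝ) : ℂ) * (α - β) / 2) (μ := (α + β - 1) / 2) hq hξ hv
      (by push_cast; ring) rfl
    rw [← hF, modWhittakerW, Real.sign_of_pos ht0, abs_of_pos ht0, abs_of_pos hpos,
      Int.sign_eq_one_of_pos hpos,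
      show (α + β) / 2 + (((1 : ℤ) : ℂ)) * ((α - β) / 2) = α by push_cast; ring]
    push_cast
    rfl

theorem eisFourierTerm_eq {n : ℤ} (hn : n ≠ 0) :
    ((√2 * π / √(N : ℝ) : ℝ) : ℂ) ^ (α + β) * eisFourierTerm N z α β n =
      (N : ℂ) ^ (-(α + β) / 2) *
        (rowCoeff α β (rescale N hN z) n * eisArith N n (α + β)) := by
  have h0 := sqrt_natCast_pos hN
  have h1 : ((√(N : ℝ) : ℝ) : ℂ) ≠ 0 := ofReal_ne_zero.2 h0.ne'
  have hN0 : (N : ℂ) ≠ 0 := by exact_mod_cast hN.ne'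
  have e1 : ((√2 * π / √(N : ℝ) : ℝ) : ℂ) ^ (α + β) =
      (N : ℂ) ^ (-(α + β) / 2) * ((√2 * π : ℝ) : ℂ) ^ (α + β) := by
    have h3 : ((√2 * π : ℝ) : ℂ) = (√(N : ℝ) : ℝ) * ((√2 * π / √(N : ℝ) : ℝ) : ℂ) := by
      rw [← ofReal_mul, mul_div_cancel₀ _ h0.ne']
    have h4 : (N : ℂ) ^ (-(α + β) / 2) * ((√(N : ℝ) : ℝ) : ℂ) ^ (α + β) = 1 := by
      rw [cpow_def_of_ne_zero h1, cpow_def_of_ne_zero hN0, ← ofReal_log h0.le,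
        Real.log_sqrt (Nat.cast_nonneg N), ← ofReal_natCast N, ← ofReal_log (Nat.cast_nonneg N),
        ← Complex.exp_add, ← Complex.exp_zero]
      congr 1
      push_cast
      ring
    rw [h3, mul_cpow_ofReal_nonneg h0.le (by positivity), ← mul_assoc, h4, one_mul]
  have e2 : cexp (2 * π * I * n * z.re / (√(N : ℝ) : ℝ)) =
      cexp (2 * π * I * n * (rescale N hN z).re) := by
    rw [rescale_re]
    congr 1
    push_cast
    ring
  rw [e1, eisFourierTerm, e2, rowCoeff, ← modWhittakerW_eq_fourier hN hq z hn]
  ring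

theorem eisConst_eq {k : ℤ} (h : α - β = k) :
    eisConst N z.im (α + β) k = 2 * riemannZeta (α + β) +
      2 * (-1) ^ (k / 2) * riemannZeta (α + β) * ((N : ℂ) ^ (-(α + β) / 2) *
        (rowCoeff α β (rescale N hN z) 0 * eisArith N 0 (α + β))) := by
  have e1 : 2 * (rescale N hN z).im = 2 * z.im / √(N : ℝ) := by
    rw [rescale_im]
    ring
  rw [rowCoeff, Int.cast_zero, fourier_linePowMul_zero (rescale N hN z).im_pos hq, eisConst, ← h, e1,
    show (α + β + (α - β)) / 2 = α by ring,
    show (α + β - (α - β)) / 2 = β by ring]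
  simp only [Int.cast_zero, mul_zero, zero_mul, Complex.exp_zero]
  ring

end

end

/-! ### Assembly of the Fourier expansion -/

theorem theorem1p2 (N : ℕ) (hN : 1 < N) (α β : ℂ) (hq : 2 < (α + β).re)
    (k : ℤ) (hk : Even k) (hαβ : α - β = (k : ℂ)) (z : UpperHalfPlane) :
    -- the series defining `g_{N,L}` and `g_{N,R}` converge absolutely
    (Summable (fun p : latticeL N => eisTermL N z α β p) ∧
      Summable (fun p : latticeR N => eisTermR N z α β p)) ∧
    -- the Dirichlet series in the coefficients converge, and the denominators do not vanish
    (∀ n : ℤ, LSeriesSummable (fun m => ramanujanG n (N * m)) (α + β) ∧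
      LSeriesSummable (fun m => ramanujanG n m) (α + β) ∧
      (∀ p ∈ N.primeFactors,
        Summable (fun m : ℕ => ramanujanG n (p ^ m) / (p : ℂ) ^ ((m : ℂ) * (α + β)))) ∧
      ramanujanLLocal N n (α + β) ≠ 0) ∧
    -- the Fourier series converges absolutely, with sum `g_N`
    Summable (fun n : {n : ℤ // n ≠ 0} => eisFourierTerm N z α β n) ∧
    eis N z α β = eisConst N z.im (α + β) k +
      2 * (-1) ^ (k / 2) * riemannZeta (α + β) *
        ((√2 * π / √(N : ℝ) : ℝ) : ℂ) ^ (α + β) *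
        ∑' n : {n : ℤ // n ≠ 0}, eisFourierTerm N z α β n := by
  have hN0 : 0 < N := by omega
  obtain ⟨hs, he⟩ := eis_eq hN0 hq hk hαβ z hN
  have hc : ((√2 * π / √(N : ℝ) : ℝ) : ℂ) ^ (α + β) ≠ 0 := by
    have := sqrt_natCast_pos hN0
    refine (Complex.cpow_ne_zero_iff_of_exponent_ne_zero ?_).2
      (Complex.ofReal_ne_zero.2 (by positivity))
    rintro h0
    simp only [h0, Complex.zero_re] at hq
    linarith
  have hs' := (hs.mul_left ((N : ℂ) ^ (-(α + β) / 2))).subtype {n : ℤ | n ≠ 0}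
  have ht : ∀ n : {n : ℤ // n ≠ 0}, _ := fun n => eisFourierTerm_eq hN0 hq z n.2
  have hF : ((√2 * π / √(N : ℝ) : ℝ) : ℂ) ^ (α + β) *
      ∑' n : {n : ℤ // n ≠ 0}, eisFourierTerm N z α β n = (N : ℂ) ^ (-(α + β) / 2) *
      ∑' n : {n : ℤ // n ≠ 0}, rowCoeff α β (rescale N hN0 z) n * eisArith N n (α + β) := by
    rw [← tsum_mul_left, tsum_congr ht, tsum_mul_left]
  refine ⟨⟨(summable_eisTermL hN0 hq hαβ z).of_norm.subtype _,
    (summable_eisTermR hN0 hq hαβ z).of_norm.subtype _⟩, fun n =>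
    ⟨lseriesSummable_ramanujanG_mul N n hq, lseriesSummable_ramanujanG n hq, fun p hp => ?_,
      ramanujanLLocal_ne_zero N n hq⟩, ?_, ?_⟩
  · have hp' := Nat.prime_of_mem_primeFactors hp
    exact (summable_term_prime_pow (lseriesSummable_ramanujanG n hq) hp').congr
      fun e => term_ramanujanG_prime_pow n _ hp' e
  · exact (summable_mul_left_iff hc).1 (hs'.congr fun n => (ht n).symm)
  · rw [he, eisConst_eq hN0 hq z hαβ, mul_assoc _ (_ ^ (α + β)), hF, add_assoc, ← mul_add, ← mul_add]
    congr 3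
    -- Frequency zero joins the `2 ζ(q)` of row zero to form the constant term.
    rw [hs.tsum_eq_add_tsum_ite 0]
    congr 1
    refine Eq.trans ?_ (tsum_subtype {n : ℤ | n ≠ 0}
      (fun n => rowCoeff α β (rescale N hN0 z) n * eisArith N n (α + β))).symm
    refine tsum_congr fun n => ?_
    by_cases hn : n = 0
    · simp [hn]
    · simp [hn]
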